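/- For a finite simple graph $G$ with vertex set $V$, let $\mathbf X_G=\sum_{\kappa}\prod_{v\in V}x_{\kappa(v)}$ be its chromatic symmetric function, the sum being over all proper colorings $\kappa:V\to\mathbb N$. Let $\mathfrak{st}_k$ be the chromatic symmetric function of the star graph on $k$ vertices and $\mathfrak{st}_\lambda=\mathfrak{st}_{\lambda_1}\mathfrak{st}_{\lambda_2}\cdots$ for a partition $\lambda$. The leading partition of $\mathbf X_G$ is the lexicographically smallest $\lambda$ with $c_\lambda\neq 0$ in the expansion $\mathbf X_G=\sum_{\lambda\vdash n}c_\lambda\,\mathfrak{st}_\lambda$, $n=|V|$. A connected unicyclic graph is a connected graph containing exactly one cycle. For $c\ge 3$ and $t\ge 0$, the cuttlefish $C_{c,t}$ is the graph on $c+t$ vertices obtained by attaching $t$ leaves to a single vertex of a cycle on $c$ vertices. Proposition. Let $G$ be a connected unicyclic graph on $n$ vertices. 1. The expansion $\mathbf X_G=\sum_{\lambda\vdash n}c_\lambda\,\mathfrak{st}_\lambda$ with $c_\lambda\in\mathbb Q$ exists and is unique, and if the cycle of $G$ has $k$ vertices, then $c_{(n)}=k-1$. 2. For all $c\ge 3$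 and $t\ge 0$: $\mathbf X_G=\mathbf X_{C_{c,t}}$ if and only if $G\cong C_{c,t}$. That is, the chromatic symmetric function distinguishes cuttlefish from all other connected unicyclic graphs. 3. For all $c\ge 3$ and $t\ge 0$: if the cycle of $G$ has $c$ vertices and $n=c+t$, then the leading partition of $\mathbf X_G$ is the partition with parts $t+1,\,2,\,1^{c-3}$ (in non-increasing order) if and only if $G\cong C_{c,t}$. -/

import Mathlib

/-- The exponent vector of the monomial `∏ v, x_{κ v}` attached to a colouring `κ`. -/
noncomputable def colorMonomial {V : Type*} [Fintype V] (κ : V → ℕ) : ℕ →₀ ℕ :=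
  ∑ v, Finsupp.single (κ v) 1

/-- A given monomial comes from only finitely many proper colourings. -/
theorem finite_coloring_colorMonomial {V : Type*} [Fintype V] (G : SimpleGraph V)
    (m : ℕ →₀ ℕ) : Finite {κ : G.Coloring ℕ // colorMonomial κ = m} := by
  classical
  have key : ∀ κ : {κ : G.Coloring ℕ // colorMonomial κ = m}, ∀ v, κ.1 v ∈ m.support := by
    rintro ⟨κ, rfl⟩ v
    rw [Finsupp.mem_support_iff]
    unfold colorMonomial
    rw [Finsupp.finsetSum_apply]
    refine ne_of_gt (lt_of_lt_of_le Nat.zero_lt_one ?_)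
    refine le_trans ?_ (Finset.single_le_sum (f := fun u => (Finsupp.single (κ u) 1 : ℕ →₀ ℕ) (κ v))
      (fun _ _ => Nat.zero_le _) (Finset.mem_univ v))
    simp
  refine Finite.of_injective
    (fun (κ : {κ : G.Coloring ℕ // colorMonomial κ = m}) (v : V) =>
      (⟨κ.1 v, key κ v⟩ : m.support)) ?_
  intro κ κ' h
  apply Subtype.ext
  apply RelHom.ext
  intro v
  exact congrArg Subtype.val (congrFun h v)

/-- The chromatic symmetric function `X_G = ∑_κ ∏_v x_{κ v}` (sum over all proper colourings
`κ : V → ℕ`), as a formal power series in countably many variables: the coefficient of a monomial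
is the number of proper colourings which produce it. -/
noncomputable def chromaticSymmetricFunction {V : Type*} [Fintype V] (G : SimpleGraph V) :
    MvPowerSeries ℕ ℚ :=
  fun m => (Nat.card {κ : G.Coloring ℕ // colorMonomial κ = m} : ℚ)

/-- The star graph on `k` vertices, with centre `0`. -/
def starOnFin : (k : ℕ) → SimpleGraph (Fin k)
  | 0 => ⊥
  | _ + 1 => SimpleGraph.starGraph 0

/-- The element `st_λ = st_{λ₁} st_{λ₂} ⋯` of the star-basis, where `st_k` is the chromatic
symmetric function of the star graph on `k` vertices. -/
noncomputable def starSymm {n : ℕ} (lam : n.Partition) : MvPowerSeries ℕ ℚ :=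
  (lam.parts.map fun k => chromaticSymmetricFunction (starOnFin k)).prod

/-- `a` is a family of coefficients `c_λ` of a star-expansion `X_G = ∑_{λ ⊢ n} c_λ st_λ`, where `n`
is the number of vertices of `G`. -/
def IsStarExpansion {V : Type*} [Fintype V] (G : SimpleGraph V)
    (a : (Fintype.card V).Partition → ℚ) : Prop :=
  chromaticSymmetricFunction G = ∑ lam, a lam • starSymm lam

/-- The parts of a partition in non-increasing order. Lists of natural numbers are compared
lexicographically. -/
def partitionList {n : ℕ} (lam : n.Partition) : List ℕ :=
  lam.parts.sort (· ≥ ·)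

/-- `lam` is the leading partition of `X_G`: the lexicographically smallest partition whose
coefficient in the star-expansion of `X_G` is non-zero. -/
def IsLeadingPartition {V : Type*} [Fintype V] (G : SimpleGraph V)
    (lam : (Fintype.card V).Partition) : Prop :=
  ∃ a, IsStarExpansion G a ∧ a lam ≠ 0 ∧ ∀ mu, a mu ≠ 0 → partitionList lam ≤ partitionList mu

/-- The subgraph `H` of `G` is a cycle on `c` vertices (`c ≥ 3`, as `G` is simple). -/
def IsCycleSubgraph {V : Type*} {G : SimpleGraph V} (H : G.Subgraph) (c : ℕ) : Prop :=
  3 ≤ c ∧ Nonempty (H.coe ≃g SimpleGraph.cycleGraph c)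

/-- A connected unicyclic graph: a connected graph that contains exactly one cycle. -/
def IsConnectedUnicyclic {V : Type*} (G : SimpleGraph V) : Prop :=
  G.Connected ∧ ∃! H : G.Subgraph, ∃ c, IsCycleSubgraph H c

/-- `G` contains a cycle of order `c`. For unicyclic `G`: the cycle of `G` has order `c`. -/
def HasCycleOfOrder {V : Type*} (G : SimpleGraph V) (c : ℕ) : Prop :=
  ∃ H : G.Subgraph, IsCycleSubgraph H c

/-- The cuttlefish `C_{c,t}`: a cycle on `c` vertices with `t` leaves attached to the vertex `0` of
the cycle. -/
def cuttlefish (c t : ℕ) : SimpleGraph (Fin c ⊕ Fin t) where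
  Adj
    | .inl i, .inl j => (SimpleGraph.cycleGraph c).Adj i j
    | .inl i, .inr _ => i.val = 0
    | .inr _, .inl j => j.val = 0
    | .inr _, .inr _ => False
  symm := ⟨by
    rintro (i | i) (j | j) h
    · exact h.symm
    · exact h
    · exact h
    · exact h⟩
  loopless := ⟨by
    rintro (i | i) h
    · exact (SimpleGraph.cycleGraph c).loopless.irrefl i h
    · exact h⟩

/-- The parts `(t + 1, 2, 1^{c-3})` of a partition of `c + t`, for `c ≥ 3`. -/
def cuttlefishParts (c t : ℕ) : Multiset ℕ :=
  (t + 1) ::ₘ 2 ::ₘ Multiset.replicate (c - 3) 1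

/-! Expand `X_G = ∑_A (-1)^|A| ∏_C p_|C|` over edge sets `A` and the components `C` they span. Power
sums are algebraically independent (`psumHom_injective`), and one involutive substitution exchanges
them with the star functions (`starHom_starHom`). Hence the stars are polynomial generators as well,
and the star-expansion exists, is unique, and is recorded by `starPoly G`.

Two specializations make its coefficients accessible. Setting `st_{k+1} = X^k` turns `p_{k+1}` into
`(1 - X)^k` and gives `rankPoly`. Linearizing at `(1, 0, 0, …)` gives `componentPoly`, whose
coefficient at `k ≥ 1` is that of the hook `(k+1, 1^{n-1-k})`. For a unicyclic graph with a
`c`-cycle, an edge set is a forest unless it contains the cycle, so `rankPoly = X^n + (-1)^c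
X^{n-c+1} (1 - X)^{c-1}`. Its coefficient at `n - 1` yields `c_(n) = c - 1`.

Let `n = c + t` with `t > 0`, and suppose that every partition occurring in `X_G` has a part
exceeding `t`. This holds if the leading partition is `(t+1, 2, 1^{c-3})`, and also for the
cuttlefish, because `t` leaves at one vertex put `X_G` into the ideal generated by the stars on more
than `t` vertices. Comparing the specializations shows that `X^{t+1}` divides `componentPoly = ∑_S
s(S) (1 - X)^{|S|-1}`, where `s(S)` is the signed number of spanning subgraphs having `S` as a
component. Since `s(S) = 0` for `|S| < c - 1`, division by `(1 - X)^{c-2}` leaves a scalar multiple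
of `X^{t+1}`; comparing its leading coefficient with its value at `1` gives `∑_{|S|=c-1} s(S) = ±
s(V) = ± (c - 1)`. But each such `s(S)` is `0` or `±1`, and it is nonzero only if `S` is the cycle
minus a vertex of degree 2 and all vertices off the cycle are leaves. So at least `c - 1` cycle
vertices have degree 2, and `G` is a cuttlefish.

Under the same supposition the hook `(t+1, 1^{c-1})` has coefficient 0 and `(t+1, 2, 1^{c-3})` has
coefficient `(-1)^c (2 - c) ≠ 0`, so the latter is leading. If `t = 0`, the vertex count forces `G`
to be the cycle. -/

/-! ### Algebraic independence of the power sums -/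

section PowerSums
open scoped Classical
open Finset

/-- The power sum `∑ i, x_i ^ w`, as a formal power series. -/
noncomputable def psumSeries (w : ℕ) : MvPowerSeries ℕ ℚ :=
  fun m => if ∃ i, m = Finsupp.single i w then 1 else 0

/-- Expanding the product picks one variable per factor; positivity of the weights makes the pick
recoverable from the exponent vector. -/
theorem coeff_prod_psumSeries {ι : Type*} [Fintype ι] (w : ι → ℕ) (hw : ∀ i, 0 < w i)
    (m : ℕ →₀ ℕ) :
    MvPowerSeries.coeff m (∏ i, psumSeries (w i)) =
      (Nat.card {κ : ι → ℕ // ∑ i, Finsupp.single (κ i) (w i) = m} : ℚ) := by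
  rw [MvPowerSeries.coeff_prod]
  have h1 : ∀ l : ι →₀ ℕ →₀ ℕ, ∏ i, MvPowerSeries.coeff (l i) (psumSeries (w i)) =
      if ∀ i, ∃ k, l i = Finsupp.single k (w i) then 1 else 0 := by
    intro l
    rw [← Fintype.prod_boole]
    rfl
  simp_rw [h1]
  rw [Finset.sum_boole, Nat.cast_inj, ← Nat.card_eq_finsetCard]
  refine Nat.card_congr (Equiv.symm ?_)
  refine Equiv.ofBijective (fun κ => ⟨Finsupp.equivFunOnFinite.symm
    (fun i => Finsupp.single (κ.1 i) (w i)), ?_⟩) ⟨?_, ?_⟩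
  · simp only [mem_filter, mem_finsuppAntidiag, Finsupp.coe_equivFunOnFinite_symm]
    exact ⟨⟨κ.2, by simp⟩, fun i => ⟨_, rfl⟩⟩
  · intro κ κ' h
    apply Subtype.ext
    funext i
    have h2 := DFunLike.congr_fun (congrArg Subtype.val h) i
    simp only [Finsupp.coe_equivFunOnFinite_symm] at h2
    exact Finsupp.single_left_injective (hw i).ne' h2
  · rintro ⟨l, hl⟩
    simp only [mem_filter, mem_finsuppAntidiag] at hl
    choose κ hκ using hl.2
    refine ⟨⟨κ, ?_⟩, ?_⟩
    · rw [← hl.1.1]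
      exact Finset.sum_congr rfl fun i _ => (hκ i).symm
    · apply Subtype.ext
      ext1 i
      simp [hκ i]

/-- Every one of the distinct variables `τ j` must be some `κ i`. With no more indices `i` than `j`,
each is hit exactly once, so the exponents agree one by one. -/
theorem map_eq_map_of_sum_single_eq {ι ι' : Type*} [Fintype ι] [Fintype ι'] {w : ι → ℕ}
    {w' : ι' → ℕ} (hw' : ∀ j, 0 < w' j) {κ : ι → ℕ} {τ : ι' → ℕ} (hτ : Function.Injective τ)
    (h : ∑ i, Finsupp.single (κ i) (w i) = ∑ j, Finsupp.single (τ j) (w' j))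
    (hc : Fintype.card ι ≤ Fintype.card ι') :
    (univ.val.map w : Multiset ℕ) = univ.val.map w' := by
  have hval : ∀ j, (∑ i, Finsupp.single (κ i) (w i)) (τ j) = w' j := by
    intro j
    rw [h, Finsupp.finsetSum_apply, Finset.sum_eq_single j]
    · simp
    · intro b _ hb
      rw [Finsupp.single_eq_of_ne]
      exact fun h => hb (hτ h.symm)
    · simp
  have hex : ∀ j, ∃ i, κ i = τ j := by
    intro j
    by_contra! hn
    have := hval j
    rw [Finsupp.finsetSum_apply, Finset.sum_eq_zero] at this
    · exact (hw' j).ne this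
    · intro i _
      rw [Finsupp.single_eq_of_ne]
      exact (hn i).symm
  choose g hg using hex
  have gi : Function.Injective g := fun a b hab => hτ (by rw [← hg a, ← hg b, hab])
  have gb : Function.Bijective g :=
    (Fintype.bijective_iff_injective_and_card g).2
      ⟨gi, le_antisymm (Fintype.card_le_of_injective g gi) hc⟩
  have key : ∀ j, w (g j) = w' j := by
    intro j
    rw [← hval j, Finsupp.finsetSum_apply, Finset.sum_eq_single (g j)]
    · simp [hg]
    · intro i _ hi
      obtain ⟨j', rfl⟩ := gb.2 i
      rw [Finsupp.single_eq_of_ne]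
      rw [hg]
      exact fun h => hi (congrArg g (hτ h.symm))
    · simp
  have : w' = w ∘ Equiv.ofBijective g gb := by
    funext j
    exact (key j).symm
  rw [this, ← Multiset.map_map]
  congr 1
  exact (congrArg Finset.val (Finset.map_univ_equiv (Equiv.ofBijective g gb))).symm

/-- The ring homomorphism which sends the `k`-th variable to the power sum of degree `k + 1`. -/
noncomputable def psumHom : MvPolynomial ℕ ℚ →ₐ[ℚ] MvPowerSeries ℕ ℚ :=
  MvPolynomial.aeval fun k => psumSeries (k + 1)

theorem Multiset.exists_fin_map {α : Type*} (s : Multiset α) :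
    ∃ f : Fin (Multiset.card s) → α, s = univ.val.map f := by
  obtain ⟨l, rfl⟩ : ∃ l : List α, (l : Multiset α) = s := Quot.exists_rep s
  refine ⟨l.get, ?_⟩
  have := Fin.univ_val_map (n := l.length) l.get
  rw [List.ofFn_get] at this
  exact this.symm

/-- Triangularity: take a monomial `d` of `q` with the most factors and test the coefficient at the
monomial that gives each factor of `d` its own variable. A product of at most as many power sums
reaches it only if it is the product for `d`. -/
theorem psumHom_injective : Function.Injective psumHom := by
  rw [injective_iff_map_eq_zero]
  intro q hq
  by_contra hne
  obtain ⟨d, hd, hmax⟩ := Finset.exists_max_image q.support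
    (fun d => Multiset.card (Finsupp.toMultiset d)) (MvPolynomial.support_nonempty.2 hne)
  obtain ⟨f, hf⟩ := Multiset.exists_fin_map (Finsupp.toMultiset d)
  set m : ℕ →₀ ℕ := ∑ i, Finsupp.single i.val (f i + 1) with hm
  have hmon : ∀ e : ℕ →₀ ℕ, ∀ g : Fin (Multiset.card (Finsupp.toMultiset e)) → ℕ,
      Finsupp.toMultiset e = univ.val.map g → psumHom (MvPolynomial.monomial e 1) =
        ∏ i, psumSeries (g i + 1) := by
    intro e g hg
    have h1 : ∏ i, psumSeries (g i + 1) =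
        (Multiset.map (fun k => psumSeries (k + 1)) (univ.val.map g)).prod := by
      rw [Multiset.map_map]
      rfl
    rw [psumHom, MvPolynomial.aeval_monomial, map_one, one_mul, h1, ← hg, Finsupp.toMultiset_map,
      Finsupp.prod_toMultiset]
    rw [Finsupp.prod_mapDomain_index (by simp) (fun _ _ _ => pow_add _ _ _)]
  have hexp : MvPowerSeries.coeff m (psumHom q) =
      ∑ e ∈ q.support, q.coeff e * MvPowerSeries.coeff m (psumHom (MvPolynomial.monomial e 1)) := by
    conv_lhs => rw [q.as_sum]
    rw [map_sum, map_sum]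
    refine Finset.sum_congr rfl fun e _ => ?_
    rw [show MvPolynomial.monomial e (q.coeff e) = q.coeff e • MvPolynomial.monomial e (1 : ℚ) by
      rw [MvPolynomial.smul_monomial, smul_eq_mul, mul_one], map_smul]
    rfl
  rw [Finset.sum_eq_single d] at hexp
  · rw [hq, map_zero, hmon d f hf, coeff_prod_psumSeries _ (fun _ => Nat.succ_pos _)] at hexp
    have h0 := MvPolynomial.mem_support_iff.1 hd
    have : Nat.card {κ : Fin (Multiset.card (Finsupp.toMultiset d)) → ℕ //
        ∑ i, Finsupp.single (κ i) (f i + 1) = m} ≠ 0 := by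
      have hfin : Finite {κ : Fin (Multiset.card (Finsupp.toMultiset d)) → ℕ //
          ∑ i, Finsupp.single (κ i) (f i + 1) = m} := by
        have : Set.Finite {κ : Fin (Multiset.card (Finsupp.toMultiset d)) → ℕ |
            ∀ i, κ i ∈ (m.support : Set ℕ)} := by
          have := Set.Finite.pi' (fun _ : Fin (Multiset.card (Finsupp.toMultiset d)) =>
            m.support.finite_toSet)
          exact this
        refine (this.subset ?_).to_subtype
        intro κ hκ i
        have hκ' : ∑ i, Finsupp.single (κ i) (f i + 1) = m := hκ
        rw [Finset.mem_coe, Finsupp.mem_support_iff, ← hκ', Finsupp.finsetSum_apply]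
        refine (lt_of_lt_of_le (Nat.succ_pos (f i)) ?_).ne'
        refine le_trans ?_ (Finset.single_le_sum
          (f := fun j => (Finsupp.single (κ j) (f j + 1)) (κ i)) (fun _ _ => Nat.zero_le _)
          (Finset.mem_univ i))
        simp
      have : Nonempty {κ : Fin (Multiset.card (Finsupp.toMultiset d)) → ℕ //
        ∑ i, Finsupp.single (κ i) (f i + 1) = m} := ⟨⟨fun i => i, rfl⟩⟩
      exact Nat.card_pos.ne'
    exact mul_ne_zero h0 (Nat.cast_ne_zero.2 this) hexp.symm
  · intro e he hed
    obtain ⟨g, hg⟩ := Multiset.exists_fin_map (Finsupp.toMultiset e)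
    rw [hmon e g hg, coeff_prod_psumSeries _ (fun _ => Nat.succ_pos _)]
    have : IsEmpty {κ : Fin (Multiset.card (Finsupp.toMultiset e)) → ℕ //
        ∑ i, Finsupp.single (κ i) (g i + 1) = m} := by
      refine ⟨fun ⟨κ, hκ⟩ => hed ?_⟩
      have := map_eq_map_of_sum_single_eq (fun _ => Nat.succ_pos _) Fin.val_injective hκ
        (by simpa only [Fintype.card_fin] using hmax e he)
      apply Function.LeftInverse.injective Finsupp.toMultiset_toFinsupp
      rw [hf, hg]
      have h2 := congrArg (Multiset.map Nat.pred) this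
      simpa [Multiset.map_map, Function.comp_def] using h2
    rw [Nat.card_of_isEmpty, Nat.cast_zero, mul_zero]
  · exact fun h => absurd hd h

end PowerSums

/-! ### The power-sum expansion over spanning subgraphs -/

section Expansion
open scoped Classical
open Finset

variable {V : Type*} [Fintype V]

/-- The vertex set of the connected component of `v`. -/
noncomputable def compOf (H : SimpleGraph V) (v : V) : Finset V :=
  univ.filter fun w => H.Reachable v w

/-- The vertex sets of the connected components of `H`. -/
noncomputable def comps (H : SimpleGraph V) : Finset (Finset V) :=
  univ.image (compOf H)

theorem mem_compOf {H : SimpleGraph V} {v w : V} : w ∈ compOf H v ↔ H.Reachable v w := by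
  simp [compOf]

theorem self_mem_compOf (H : SimpleGraph V) (v : V) : v ∈ compOf H v :=
  mem_compOf.2 (SimpleGraph.Reachable.refl v)

theorem compOf_mem_comps (H : SimpleGraph V) (v : V) : compOf H v ∈ comps H :=
  mem_image_of_mem _ (mem_univ v)

theorem compOf_eq_compOf_iff {H : SimpleGraph V} {v w : V} :
    compOf H v = compOf H w ↔ H.Reachable v w := by
  constructor
  · intro h
    rw [← mem_compOf, h]
    exact self_mem_compOf H w
  · intro h
    ext x
    rw [mem_compOf, mem_compOf]
    exact ⟨fun hx => h.symm.trans hx, fun hx => h.trans hx⟩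

theorem eq_compOf_of_mem {H : SimpleGraph V} {S : Finset V} (hS : S ∈ comps H) {v : V}
    (hv : v ∈ S) : S = compOf H v := by
  obtain ⟨w, -, rfl⟩ := mem_image.1 hS
  exact compOf_eq_compOf_iff.2 (mem_compOf.1 hv)

theorem nonempty_of_mem_comps {H : SimpleGraph V} {S : Finset V} (hS : S ∈ comps H) :
    S.Nonempty := by
  obtain ⟨w, -, rfl⟩ := mem_image.1 hS
  exact ⟨w, self_mem_compOf H w⟩

theorem card_pos_of_mem_comps {H : SimpleGraph V} {S : Finset V} (hS : S ∈ comps H) : 0 < #S :=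
  (nonempty_of_mem_comps hS).card_pos

theorem sum_card_comps (H : SimpleGraph V) : ∑ S ∈ comps H, #S = Fintype.card V := by
  rw [← Finset.card_univ, Finset.card_eq_sum_card_fiberwise (t := comps H) (f := compOf H)
    (fun v _ => compOf_mem_comps H v)]
  refine Finset.sum_congr rfl fun S hS => ?_
  congr 1
  ext v
  simp only [mem_filter, mem_univ, true_and]
  constructor
  · exact fun hv => (eq_compOf_of_mem hS hv).symm
  · rintro rfl
    exact self_mem_compOf H v

/-- The subgraph expansion `∑_A (-1)^|A| ∏_C p_{|C|}` of the chromatic symmetric function, with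
the power sum of degree `k + 1` represented by the `k`-th variable. -/
noncomputable def powerSumPoly (G : SimpleGraph V) : MvPolynomial ℕ ℚ :=
  ∑ A ∈ G.edgeFinset.powerset, (-1) ^ #A *
    ∏ S ∈ comps (SimpleGraph.fromEdgeSet (A : Set (Sym2 V))), MvPolynomial.X (#S - 1)

theorem prod_one_sub_boole {α : Type*} (s : Finset α) (p : α → Prop) :
    (if ∀ e ∈ s, ¬ p e then (1 : ℚ) else 0) =
      ∑ A ∈ s.powerset, (-1) ^ #A * if ∀ e ∈ A, p e then 1 else 0 := by
  have h1 : (if ∀ e ∈ s, ¬ p e then (1 : ℚ) else 0) = ∏ e ∈ s, ((-if p e then 1 else 0) + 1) := by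
    rw [← Finset.prod_boole]
    refine Finset.prod_congr rfl fun e _ => ?_
    by_cases h : p e <;> simp [h]
  rw [h1, Finset.prod_add_one]
  refine Finset.sum_congr rfl fun A _ => ?_
  rw [Finset.prod_neg, Finset.prod_boole]

theorem colorMonomial_eq_of_const {H : SimpleGraph V} (τ : comps H → ℕ) :
    colorMonomial (fun v => τ ⟨compOf H v, compOf_mem_comps H v⟩) =
      ∑ S : comps H, Finsupp.single (τ S) (#S.1) := by
  unfold colorMonomial
  rw [← Finset.sum_fiberwise_of_maps_to (t := univ)
    (g := fun v => (⟨compOf H v, compOf_mem_comps H v⟩ : comps H)) (fun _ _ => mem_univ _)]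
  refine Finset.sum_congr rfl fun S _ => ?_
  have h1 : ∀ v ∈ univ.filter (fun v => (⟨compOf H v, compOf_mem_comps H v⟩ : comps H) = S),
      Finsupp.single (τ ⟨compOf H v, compOf_mem_comps H v⟩) 1 = Finsupp.single (τ S) 1 := by
    intro v hv
    rw [(mem_filter.1 hv).2]
  have h2 : univ.filter (fun v => (⟨compOf H v, compOf_mem_comps H v⟩ : comps H) = S) = S.1 := by
    ext v
    simp only [mem_filter, mem_univ, true_and]
    constructor
    · rintro rfl
      exact self_mem_compOf H v
    · intro hv
      exact Subtype.ext (eq_compOf_of_mem S.2 hv).symm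
  rw [Finset.sum_congr rfl h1, h2, Finset.sum_const, Finsupp.smul_single, smul_eq_mul, mul_one]

theorem const_of_reachable {V : Type*} {A : Finset (Sym2 V)} {κ : V → ℕ}
    (h : ∀ e ∈ A, (e.map κ).IsDiag) {v w : V}
    (hvw : (SimpleGraph.fromEdgeSet (A : Set (Sym2 V))).Reachable v w) : κ v = κ w := by
  obtain ⟨p⟩ := hvw
  induction p with
  | nil => rfl
  | cons hadj _ ih =>
    rw [← ih]
    have := h _ ((SimpleGraph.fromEdgeSet_adj _).1 hadj).1
    simpa using this

/-- Such colourings are functions on the components. Looplessness of `A` guarantees that each of its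
members is an edge of `fromEdgeSet`. -/
theorem card_const_colorings (A : Finset (Sym2 V)) (hA : ∀ e ∈ A, ¬ e.IsDiag) (m : ℕ →₀ ℕ) :
    Nat.card {κ : V → ℕ // colorMonomial κ = m ∧ ∀ e ∈ A, (e.map κ).IsDiag} =
      Nat.card {τ : comps (SimpleGraph.fromEdgeSet (A : Set (Sym2 V))) → ℕ //
        ∑ S, Finsupp.single (τ S) (#S.1) = m} := by
  refine Nat.card_congr (Equiv.symm (Equiv.ofBijective (fun τ => ⟨fun v => τ.1
    ⟨compOf _ v, compOf_mem_comps _ v⟩, ?_, ?_⟩) ⟨?_, ?_⟩))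
  · rw [colorMonomial_eq_of_const]
    exact τ.2
  · intro e he
    induction e with
    | h x y =>
      have hxy : (SimpleGraph.fromEdgeSet (A : Set (Sym2 V))).Adj x y := by
        rw [SimpleGraph.fromEdgeSet_adj]
        exact ⟨he, fun h => hA _ he (by simpa using h)⟩
      have := compOf_eq_compOf_iff.2 hxy.reachable
      simp [this]
  · intro τ τ' h
    apply Subtype.ext
    funext S
    obtain ⟨v, hv⟩ := nonempty_of_mem_comps S.2
    have h1 := congrFun (congrArg Subtype.val h) v
    have h2 : (⟨compOf _ v, compOf_mem_comps _ v⟩ : comps _) = S :=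
      Subtype.ext (eq_compOf_of_mem S.2 hv).symm
    simp only [h2] at h1
    exact h1
  · rintro ⟨κ, hm, hκ⟩
    have h2 : ∀ v, κ (nonempty_of_mem_comps (compOf_mem_comps
        (SimpleGraph.fromEdgeSet (A : Set (Sym2 V))) v)).choose = κ v := by
      intro v
      refine (const_of_reachable hκ (mem_compOf.1 ?_)).symm
      exact (nonempty_of_mem_comps (compOf_mem_comps _ v)).choose_spec
    refine ⟨⟨fun S => κ (nonempty_of_mem_comps S.2).choose, ?_⟩, ?_⟩
    · rw [← colorMonomial_eq_of_const (fun S => κ (nonempty_of_mem_comps S.2).choose)]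
      simp only [h2]
      exact hm
    · exact Subtype.ext (funext h2)

theorem finite_colorMonomial_eq (m : ℕ →₀ ℕ) : Set.Finite {κ : V → ℕ | colorMonomial κ = m} := by
  have := finite_coloring_colorMonomial (⊥ : SimpleGraph V) m
  refine (Set.finite_range fun κ : {κ : (⊥ : SimpleGraph V).Coloring ℕ // colorMonomial κ = m} =>
    (κ.1 : V → ℕ)).subset ?_
  intro κ hκ
  exact ⟨⟨⟨κ, fun h => absurd h (by simp)⟩, hκ⟩, rfl⟩

/-- Inclusion–exclusion over the monochromatic edges: for a fixed `A`, the colourings constant along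
`A` contribute one power sum per component. -/
theorem chromaticSymmetricFunction_eq_psumHom (G : SimpleGraph V) :
    chromaticSymmetricFunction G = psumHom (powerSumPoly G) := by
  ext m
  have hfin : Set.Finite {κ : V → ℕ | colorMonomial κ = m} := finite_colorMonomial_eq m
  have hprop : (Nat.card {κ : G.Coloring ℕ // colorMonomial κ = m} : ℚ) =
      ∑ κ ∈ hfin.toFinset, if ∀ e ∈ G.edgeFinset, ¬ (e.map κ).IsDiag then (1 : ℚ) else 0 := by
    rw [Finset.sum_boole, Nat.cast_inj, ← Nat.card_eq_finsetCard]
    have hiff : ∀ κ : V → ℕ, (∀ e ∈ G.edgeFinset, ¬ (e.map κ).IsDiag) ↔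
        ∀ x y, G.Adj x y → κ x ≠ κ y := by
      intro κ
      constructor
      · intro h x y hxy
        have := h s(x, y) (by simpa using hxy)
        simpa using this
      · intro h e he
        induction e with
        | h x y => simpa using h x y (by simpa using he)
    refine Nat.card_congr ⟨fun κ => ⟨κ.1, ?_⟩, fun κ => ⟨⟨κ.1, ?_⟩, ?_⟩, ?_, ?_⟩
    · rw [mem_filter, hiff, Set.Finite.mem_toFinset]
      exact ⟨κ.2, fun x y hxy => κ.1.valid hxy⟩
    · have := κ.2
      rw [mem_filter, hiff] at this
      exact fun {x y} hxy => this.2 x y hxy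
    · have := κ.2
      rw [mem_filter, Set.Finite.mem_toFinset] at this
      exact this.1
    · exact fun _ => rfl
    · exact fun _ => rfl
  have hl : MvPowerSeries.coeff m (chromaticSymmetricFunction G) =
    (Nat.card {κ : G.Coloring ℕ // colorMonomial κ = m} : ℚ) := rfl
  have hexp : ∀ κ ∈ hfin.toFinset,
      (if ∀ e ∈ G.edgeFinset, ¬ (e.map κ).IsDiag then (1 : ℚ) else 0) =
        ∑ A ∈ G.edgeFinset.powerset,
          (-1) ^ #A * if ∀ e ∈ A, (e.map κ).IsDiag then (1 : ℚ) else 0 := by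
    intro κ _
    convert prod_one_sub_boole G.edgeFinset fun e => (e.map κ).IsDiag
  rw [hl, hprop, Finset.sum_congr rfl hexp, Finset.sum_comm, powerSumPoly, map_sum, map_sum]
  refine Finset.sum_congr rfl fun A hA => ?_
  rw [← Finset.mul_sum, Finset.sum_boole]
  have h1 : psumHom ((-1) ^ #A * ∏ S ∈ comps (SimpleGraph.fromEdgeSet (A : Set (Sym2 V))),
      MvPolynomial.X (#S - 1)) = ((-1 : ℚ) ^ #A) •
        ∏ S : comps (SimpleGraph.fromEdgeSet (A : Set (Sym2 V))), psumSeries (#S.1) := by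
    rw [map_mul, map_pow, map_neg, map_one, map_prod, ← Finset.prod_coe_sort]
    have h2 : ∀ S : comps (SimpleGraph.fromEdgeSet (A : Set (Sym2 V))),
        psumHom (MvPolynomial.X (#S.1 - 1)) = psumSeries (#S.1) := by
      intro S
      rw [psumHom, MvPolynomial.aeval_X, Nat.sub_add_cancel (card_pos_of_mem_comps S.2)]
    rw [Finset.prod_congr rfl fun S _ => h2 S, Algebra.smul_def]
    simp
  rw [h1, map_smul, coeff_prod_psumSeries _ (fun S => card_pos_of_mem_comps S.2), smul_eq_mul,
    ← card_const_colorings]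
  · congr 2
    refine (Nat.card_eq_finsetCard _).symm.trans (Nat.card_congr ?_)
    refine Equiv.subtypeEquivRight fun κ => ?_
    rw [mem_filter, Set.Finite.mem_toFinset]
    rfl
  · intro e he
    exact G.not_isDiag_of_mem_edgeFinset (mem_powerset.1 hA he)

end Expansion

/-! ### Pendant leaves, and the involution between stars and power sums -/

section Pendant
open scoped Classical
open Finset

/-- The `t`-th iterated difference `∑ j, (-1)^j (t choose j) a 0 ^ (t - j) * a (m + j)`. -/
def iterDiff {R : Type*} [CommRing R] (a : ℕ → R) : ℕ → ℕ → R
  | 0, m => a m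
  | t + 1, m => a 0 * iterDiff a t m - iterDiff a t (m + 1)

theorem iterDiff_map {R R' : Type*} [CommRing R] [CommRing R'] (f : R →+* R') (a : ℕ → R)
    (t m : ℕ) : f (iterDiff a t m) = iterDiff (fun k => f (a k)) t m := by
  induction t generalizing m with
  | zero => rfl
  | succ t ih => simp only [iterDiff, map_sub, map_mul, ih]

/-- Each element of `s` plays the role of a leaf: left out, it is a singleton component and
contributes `a 0`; taken in, it enlarges its neighbour's component by one. -/
theorem sum_powerset_iterDiff {R α : Type*} [CommRing R] (a : ℕ → R) (s : Finset α) (m : ℕ) :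
    ∑ B ∈ s.powerset, (-1) ^ #B * (a 0 ^ (#s - #B) * a (m + #B)) = iterDiff a #s m := by
  induction s using Finset.induction_on generalizing m with
  | empty => simp [iterDiff]
  | insert x s hx ih =>
    rw [Finset.sum_powerset_insert hx, card_insert_of_notMem hx, iterDiff, ← ih, ← ih,
      Finset.mul_sum, sub_eq_add_neg, ← Finset.sum_neg_distrib]
    congr 1
    · refine Finset.sum_congr rfl fun B hB => ?_
      have := card_le_card (mem_powerset.1 hB)
      rw [Nat.succ_sub this, pow_succ]
      ring
    · refine Finset.sum_congr rfl fun B hB => ?_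
      have hxB : x ∉ B := fun h => hx (mem_powerset.1 hB h)
      rw [card_insert_of_notMem hxB, Nat.add_sub_add_right, pow_succ,
        show m + (#B + 1) = m + 1 + #B by ring]
      ring

/-- The algebra homomorphism which sends the `m`-th variable to the expression of the chromatic
symmetric function of the star on `m + 1` vertices in power sums. -/
noncomputable def starHom : MvPolynomial ℕ ℚ →ₐ[ℚ] MvPolynomial ℕ ℚ :=
  MvPolynomial.aeval fun m => iterDiff MvPolynomial.X m 0

theorem starHom_X (m : ℕ) : starHom (MvPolynomial.X m) = iterDiff MvPolynomial.X m 0 := by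
  rw [starHom, MvPolynomial.aeval_X]

/-- Writing `D t m` for the difference, the images satisfy `X 0 * D m t - D (m + 1) t = D m (t +
1)`, which is the defining recursion solved for its last term. This symmetry makes `starHom` an
involution, and later converts `t` leaves into star indices at least `t`. -/
theorem starHom_iterDiff (t m : ℕ) :
    starHom (iterDiff MvPolynomial.X t m) = iterDiff MvPolynomial.X m t := by
  induction t generalizing m with
  | zero => exact starHom_X m
  | succ t ih =>
    rw [iterDiff, map_sub, map_mul, ih, ih, starHom_X]
    simp only [iterDiff]
    ring

theorem starHom_starHom (q : MvPolynomial ℕ ℚ) : starHom (starHom q) = q := by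
  have : starHom.comp starHom = AlgHom.id ℚ _ := by
    apply MvPolynomial.algHom_ext
    intro m
    rw [AlgHom.comp_apply, starHom_X, starHom_iterDiff]
    rfl
  exact DFunLike.congr_fun this q

theorem starHom_injective : Function.Injective starHom :=
  Function.LeftInverse.injective starHom_starHom

variable {V : Type*} [Fintype V]

theorem compOf_eq {H : SimpleGraph V} {v : V} {T : Finset V} (hv : v ∈ T)
    (hT : ∀ x ∈ T, ∀ y, H.Adj x y → y ∈ T) (hr : ∀ w ∈ T, H.Reachable v w) : compOf H v = T := by
  ext w
  rw [mem_compOf]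
  refine ⟨?_, hr w⟩
  rintro ⟨p⟩
  induction p with
  | nil => exact hv
  | cons hadj p ih => exact ih (hT _ hv _ hadj) fun w hw => (hadj.reachable.symm).trans (hr w hw)

theorem mem_comps_iff {H : SimpleGraph V} {T : Finset V} :
    T ∈ comps H ↔ ∃ v, compOf H v = T := by
  simp [comps]

/-- `Λ` is a set of leaves, all of them attached to `v`. -/
def IsPendantSet {V : Type*} (G : SimpleGraph V) (v : V) (Λ : Finset V) : Prop :=
  v ∉ Λ ∧ ∀ x ∈ Λ, ∀ y, G.Adj x y ↔ y = v

/-- The edges between `v` and the vertices in `B`. -/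
noncomputable def spokes {V : Type*} (v : V) (B : Finset V) : Finset (Sym2 V) := B.image fun x => s(v, x)

theorem mem_spokes {V : Type*} {v x y : V} {B : Finset V} :
    s(x, y) ∈ spokes v B ↔ (x = v ∧ y ∈ B) ∨ (y = v ∧ x ∈ B) := by
  simp only [spokes, mem_image, Sym2.eq_iff]
  constructor
  · rintro ⟨z, hz, (⟨rfl, rfl⟩ | ⟨rfl, rfl⟩)⟩
    · exact Or.inl ⟨rfl, hz⟩
    · exact Or.inr ⟨rfl, hz⟩
  · rintro (⟨rfl, h⟩ | ⟨rfl, h⟩)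
    · exact ⟨y, h, Or.inl ⟨rfl, rfl⟩⟩
    · exact ⟨x, h, Or.inr ⟨rfl, rfl⟩⟩

theorem spokes_subset {G : SimpleGraph V} {v : V} {Λ : Finset V} (h : IsPendantSet G v Λ) :
    spokes v Λ ⊆ G.edgeFinset := by
  intro e he
  obtain ⟨x, hx, rfl⟩ := mem_image.1 he
  rw [SimpleGraph.mem_edgeFinset, SimpleGraph.mem_edgeSet]
  exact ((h.2 x hx v).2 rfl).symm

theorem card_spokes {V : Type*} (v : V) (B : Finset V) : #(spokes v B) = #B := by
  refine card_image_of_injective _ fun x y h => ?_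
  exact Sym2.congr_right.1 h

theorem sum_powerset_edgeFinset_pendant {R : Type*} [AddCommMonoid R] {G : SimpleGraph V} {v : V}
    {Λ : Finset V} (h : IsPendantSet G v Λ) (F : Finset (Sym2 V) → R) :
    ∑ A ∈ G.edgeFinset.powerset, F A =
      ∑ A ∈ (G.edgeFinset \ spokes v Λ).powerset, ∑ B ∈ Λ.powerset, F (A ∪ spokes v B) := by
  rw [← Finset.sum_product']
  refine Finset.sum_nbij' (fun A => (A \ spokes v Λ, Λ.filter fun x => s(v, x) ∈ A))
    (fun AB => AB.1 ∪ spokes v AB.2) ?_ ?_ ?_ ?_ ?_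
  · intro A hA
    rw [mem_product, mem_powerset, mem_powerset]
    exact ⟨sdiff_subset_sdiff (mem_powerset.1 hA) le_rfl, filter_subset _ _⟩
  · intro AB hAB
    rw [mem_product, mem_powerset, mem_powerset] at hAB
    rw [mem_powerset]
    exact union_subset (hAB.1.trans sdiff_subset)
      ((image_subset_image hAB.2).trans (spokes_subset h))
  · intro A hA
    ext e
    simp only [mem_union, mem_sdiff, spokes, mem_image, mem_filter]
    constructor
    · rintro (h | ⟨x, ⟨_, h⟩, rfl⟩)
      · exact h.1
      · exact h
    · intro he
      by_cases hx : ∃ a ∈ Λ, s(v, a) = e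
      · obtain ⟨a, ha, rfl⟩ := hx
        exact Or.inr ⟨a, ⟨ha, he⟩, rfl⟩
      · exact Or.inl ⟨he, hx⟩
  · rintro ⟨A, B⟩ hAB
    simp only [mem_product, mem_powerset] at hAB
    have hB : spokes v B ⊆ spokes v Λ := image_subset_image hAB.2
    have hA : ∀ e ∈ A, e ∉ spokes v Λ := fun e he => (mem_sdiff.1 (hAB.1 he)).2
    ext e
    · simp only [mem_sdiff, mem_union]
      constructor
      · rintro ⟨h1 | h1, h2⟩
        · exact h1
        · exact absurd (hB h1) h2
      · exact fun he => ⟨Or.inl he, hA e he⟩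
    · simp only [mem_filter, mem_union]
      constructor
      · rintro ⟨he, h1 | h1⟩
        · exact absurd (mem_image_of_mem _ he) (hA _ h1)
        · obtain ⟨x, hx, hxe⟩ := mem_image.1 h1
          have : x = e := Sym2.congr_right.1 hxe
          exact this ▸ hx
      · exact fun he => ⟨hAB.2 he, Or.inr (mem_image_of_mem _ he)⟩
  · intro A hA
    congr 1
    ext e
    simp only [mem_union, mem_sdiff, spokes, mem_image, mem_filter]
    constructor
    · intro he
      by_cases hx : ∃ a ∈ Λ, s(v, a) = e
      · obtain ⟨a, ha, rfl⟩ := hx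
        exact Or.inr ⟨a, ⟨ha, he⟩, rfl⟩
      · exact Or.inl ⟨he, hx⟩
    · rintro (h | ⟨x, ⟨_, h⟩, rfl⟩)
      · exact h.1
      · exact h

/-- Without the spokes every leaf is isolated, so adding those to `B` only enlarges the component of
`v`. -/
theorem comps_union_spokes {G : SimpleGraph V} {v : V} {Λ : Finset V} (h : IsPendantSet G v Λ)
    {A : Finset (Sym2 V)} (hA : A ⊆ G.edgeFinset \ spokes v Λ) {B : Finset V} (hB : B ⊆ Λ) :
    comps (SimpleGraph.fromEdgeSet ((A ∪ spokes v B : Finset _) : Set (Sym2 V))) =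
      (comps (SimpleGraph.fromEdgeSet (A : Set (Sym2 V)))).filter
          (fun S => Disjoint S (insert v Λ)) ∪
        insert (compOf (SimpleGraph.fromEdgeSet (A : Set (Sym2 V))) v ∪ B)
          ((Λ \ B).image fun x => {x}) := by
  set H := SimpleGraph.fromEdgeSet (A : Set (Sym2 V)) with hH
  set H' := SimpleGraph.fromEdgeSet ((A ∪ spokes v B : Finset _) : Set (Sym2 V)) with hH'
  have hle : H ≤ H' := SimpleGraph.fromEdgeSet_mono (by simp)
  have hadj : ∀ x y, H'.Adj x y → H.Adj x y ∨ (x = v ∧ y ∈ B) ∨ (y = v ∧ x ∈ B) := by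
    intro x y hxy
    rw [hH', SimpleGraph.fromEdgeSet_adj, mem_coe, mem_union, mem_spokes] at hxy
    rcases hxy.1 with h1 | h1
    · exact Or.inl ((SimpleGraph.fromEdgeSet_adj _).2 ⟨h1, hxy.2⟩)
    · exact Or.inr h1
  have hiso : ∀ x ∈ Λ, ∀ y, ¬ H.Adj x y := by
    intro x hx y hxy
    have h1 := mem_sdiff.1 (hA ((SimpleGraph.fromEdgeSet_adj _).1 hxy).1)
    have h2 := (h.2 x hx y).1 (by simpa using h1.1)
    subst h2
    exact h1.2 (mem_spokes.2 (Or.inr ⟨rfl, hx⟩))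
  have hisoc : ∀ x ∈ Λ, compOf H x = {x} := by
    intro x hx
    refine compOf_eq (mem_singleton_self x) ?_ ?_
    · intro y hy z hyz
      rw [mem_singleton.1 hy] at hyz
      exact absurd hyz (hiso x hx z)
    · intro y hy
      rw [mem_singleton.1 hy]
  have hv' : compOf H' v = compOf H v ∪ B := by
    refine compOf_eq (mem_union_left _ (self_mem_compOf H v)) ?_ ?_
    · intro x hx y hxy
      rcases hadj x y hxy with h1 | h1 | h1
      · rcases mem_union.1 hx with h2 | h2
        · exact mem_union_left _ (mem_compOf.2 ((mem_compOf.1 h2).trans h1.reachable))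
        · exact absurd h1 (hiso x (hB h2) y)
      · exact mem_union_right _ h1.2
      · rw [h1.1]
        exact mem_union_left _ (self_mem_compOf H v)
    · intro w hw
      rcases mem_union.1 hw with h2 | h2
      · exact (mem_compOf.1 h2).mono hle
      · refine SimpleGraph.Adj.reachable ?_
        rw [hH', SimpleGraph.fromEdgeSet_adj, mem_coe, mem_union, mem_spokes]
        exact ⟨Or.inr (Or.inl ⟨rfl, h2⟩), fun h3 => h.1 (h3 ▸ hB h2)⟩
  have hx' : ∀ x ∈ Λ \ B, compOf H' x = {x} := by
    intro x hx
    rw [mem_sdiff] at hx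
    refine compOf_eq (mem_singleton_self x) ?_ ?_
    · intro y hy z hyz
      rw [mem_singleton.1 hy] at hyz
      rcases hadj x z hyz with h1 | h1 | h1
      · exact absurd h1 (hiso x hx.1 z)
      · exact absurd (h1.1 ▸ hx.1) h.1
      · exact absurd h1.2 hx.2
    · intro y hy
      rw [mem_singleton.1 hy]
  have hw' : ∀ w, Disjoint (compOf H w) (insert v Λ) → compOf H' w = compOf H w := by
    intro w hw
    rw [disjoint_insert_right, disjoint_right] at hw
    refine compOf_eq (self_mem_compOf H w) ?_ ?_
    · intro x hx y hxy
      rcases hadj x y hxy with h1 | h1 | h1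
      · exact mem_compOf.2 ((mem_compOf.1 hx).trans h1.reachable)
      · exact absurd (h1.1 ▸ hx) hw.1
      · exact absurd hx (hw.2 (hB h1.2))
    · intro y hy
      exact (mem_compOf.1 hy).mono hle
  ext T
  rw [mem_union, mem_insert, mem_image, mem_filter]
  constructor
  · intro hT
    obtain ⟨w, rfl⟩ := mem_comps_iff.1 hT
    by_cases h1 : Disjoint (compOf H w) (insert v Λ)
    · exact Or.inl ⟨by rw [hw' w h1]; exact compOf_mem_comps H w, by rw [hw' w h1]; exact h1⟩
    · right
      rw [not_disjoint_iff] at h1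
      obtain ⟨x, hx, hx2⟩ := h1
      have hxw : compOf H' w = compOf H' x :=
        compOf_eq_compOf_iff.2 ((mem_compOf.1 hx).mono hle)
      rw [hxw]
      rcases mem_insert.1 hx2 with rfl | hx3
      · exact Or.inl hv'
      · by_cases hxB : x ∈ B
        · left
          rw [← hv', compOf_eq_compOf_iff, SimpleGraph.reachable_comm, ← mem_compOf, hv']
          exact mem_union_right _ hxB
        · exact Or.inr ⟨x, mem_sdiff.2 ⟨hx3, hxB⟩, (hx' x (mem_sdiff.2 ⟨hx3, hxB⟩)).symm⟩
  · rintro (⟨h1, h2⟩ | rfl | ⟨x, hx, rfl⟩)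
    · obtain ⟨w, rfl⟩ := mem_comps_iff.1 h1
      rw [← hw' w h2]
      exact compOf_mem_comps _ _
    · rw [← hv']
      exact compOf_mem_comps _ _
    · rw [← hx' x hx]
      exact compOf_mem_comps _ _

/-- For a fixed edge set off the spokes, summing over the sets of joined leaves produces an iterated
difference of order `#Λ`. -/
theorem powerSumPoly_pendant {G : SimpleGraph V} {v : V} {Λ : Finset V} (h : IsPendantSet G v Λ) :
    powerSumPoly G = ∑ A ∈ (G.edgeFinset \ spokes v Λ).powerset, (-1) ^ #A *
      ((∏ S ∈ (comps (SimpleGraph.fromEdgeSet (A : Set (Sym2 V)))).filter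
          (fun S => Disjoint S (insert v Λ)), MvPolynomial.X (#S - 1)) *
        iterDiff MvPolynomial.X #Λ
          (#(compOf (SimpleGraph.fromEdgeSet (A : Set (Sym2 V))) v) - 1)) := by
  rw [powerSumPoly, sum_powerset_edgeFinset_pendant h]
  refine Finset.sum_congr rfl fun A hA => ?_
  rw [mem_powerset] at hA
  rw [← sum_powerset_iterDiff, Finset.mul_sum, Finset.mul_sum]
  refine Finset.sum_congr rfl fun B hB => ?_
  rw [mem_powerset] at hB
  set H := SimpleGraph.fromEdgeSet (A : Set (Sym2 V)) with hH
  have hΛ : ∀ x ∈ Λ, x ∉ compOf H v := by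
    intro x hx hxv
    obtain ⟨p⟩ := (mem_compOf.1 hxv).symm
    cases p with
    | nil => exact h.1 hx
    | cons hadj _ =>
      have h1 := mem_sdiff.1 (hA ((SimpleGraph.fromEdgeSet_adj _).1 hadj).1)
      have h2 := (h.2 x hx _).1 (by simpa using h1.1)
      subst h2
      exact h1.2 (mem_spokes.2 (Or.inr ⟨rfl, hx⟩))
  have hcard : #(A ∪ spokes v B) = #A + #B := by
    rw [card_union_of_disjoint, card_spokes]
    refine disjoint_left.2 fun e he he2 => (mem_sdiff.1 (hA he)).2 ?_
    exact image_subset_image hB he2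
  have hc : #(compOf H v ∪ B) = #(compOf H v) + #B :=
    card_union_of_disjoint (disjoint_right.2 fun x hx => hΛ x (hB hx))
  have hpos : 0 < #(compOf H v) := card_pos.2 ⟨v, self_mem_compOf H v⟩
  rw [comps_union_spokes h hA hB, hcard, prod_union, prod_insert, prod_image, hc]
  simp only [card_singleton, Nat.sub_self]
  rw [Finset.prod_const,
    card_sdiff_of_subset hB, pow_add, ← hH,
    show #(compOf H v) + #B - 1 = #(compOf H v) - 1 + #B by omega]
  · ring
  · intro x _ y _ hxy
    simpa using hxy
  · intro h1
    obtain ⟨x, hx, hx2⟩ := mem_image.1 h1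
    have : v ∈ ({x} : Finset V) := by
      rw [hx2]
      exact mem_union_left _ (self_mem_compOf H v)
    rw [mem_singleton] at this
    exact h.1 (this ▸ (mem_sdiff.1 hx).1)
  · rw [disjoint_left]
    intro S hS hS2
    have hS3 := (mem_filter.1 hS).2
    rcases mem_insert.1 hS2 with rfl | h3
    · exact disjoint_left.1 hS3 (mem_union_left _ (self_mem_compOf H v)) (mem_insert_self _ _)
    · obtain ⟨x, hx, rfl⟩ := mem_image.1 h3
      exact disjoint_left.1 hS3 (mem_singleton_self x)
        (mem_insert_of_mem (mem_sdiff.1 hx).1)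

theorem isPendantSet_star (k : ℕ) :
    IsPendantSet (starOnFin (k + 1)) 0 (univ.erase (0 : Fin (k + 1))) := by
  refine ⟨by simp, fun x hx y => ?_⟩
  have hx0 : x ≠ 0 := (mem_erase.1 hx).1
  simp only [starOnFin, SimpleGraph.starGraph_adj]
  grind

theorem powerSumPoly_of_isPendantSet_erase {G : SimpleGraph V} {v : V}
    (h : IsPendantSet G v (univ.erase v)) :
    powerSumPoly G = iterDiff MvPolynomial.X (Fintype.card V - 1) 0 := by
  rw [powerSumPoly_pendant h]
  have h1 : G.edgeFinset \ spokes v (univ.erase v) = ∅ := by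
    rw [sdiff_eq_empty_iff_subset]
    intro e he
    induction e with
    | h x y =>
      rw [mem_spokes]
      rw [SimpleGraph.mem_edgeFinset, SimpleGraph.mem_edgeSet] at he
      simp only [mem_erase, mem_univ, and_true]
      by_cases hx : x = v
      · exact Or.inl ⟨hx, fun hy => he.ne (hx.trans hy.symm)⟩
      · exact Or.inr ⟨(h.2 x (mem_erase.2 ⟨hx, mem_univ x⟩) y).1 he, hx⟩
  rw [h1, powerset_empty, sum_singleton, card_empty, pow_zero, one_mul, filter_false_of_mem,
    prod_empty, one_mul, card_erase_of_mem (mem_univ _), card_univ]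
  · congr 1
    rw [compOf_eq (T := {v}) (mem_singleton_self _)]
    · simp
    · intro x _ y hxy
      simp at hxy
    · intro w hw
      rw [mem_singleton.1 hw]
  · intro S hS
    obtain ⟨x, hx⟩ := nonempty_of_mem_comps hS
    refine not_disjoint_iff.2 ⟨x, hx, ?_⟩
    simp

theorem chromaticSymmetricFunction_star (k : ℕ) :
    chromaticSymmetricFunction (starOnFin (k + 1)) = psumHom (starHom (MvPolynomial.X k)) := by
  rw [chromaticSymmetricFunction_eq_psumHom,
    powerSumPoly_of_isPendantSet_erase (v := 0) (by convert isPendantSet_star k), starHom_X, Fintype.card_fin,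
    Nat.add_sub_cancel]

end Pendant

/-! ### Existence, uniqueness and homogeneity of the star-expansion -/

section StarExpansion
open scoped Classical
open Finset

variable {V : Type*} [Fintype V]

/-- The polynomial which represents the star-expansion of the chromatic symmetric function: the
`k`-th variable stands for the star on `k + 1` vertices. -/
noncomputable def starPoly (G : SimpleGraph V) : MvPolynomial ℕ ℚ := starHom (powerSumPoly G)

/-- The algebra homomorphism which sends the `k`-th variable to the chromatic symmetric function
of the star on `k + 1` vertices. -/
noncomputable def starSeriesHom : MvPolynomial ℕ ℚ →ₐ[ℚ] MvPowerSeries ℕ ℚ :=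
  psumHom.comp starHom

theorem starSeriesHom_injective : Function.Injective starSeriesHom :=
  psumHom_injective.comp starHom_injective

theorem starSeriesHom_X (k : ℕ) :
    starSeriesHom (MvPolynomial.X k) = chromaticSymmetricFunction (starOnFin (k + 1)) :=
  (chromaticSymmetricFunction_star k).symm

theorem starSeriesHom_starPoly (G : SimpleGraph V) :
    starSeriesHom (starPoly G) = chromaticSymmetricFunction G := by
  rw [chromaticSymmetricFunction_eq_psumHom, starSeriesHom, starPoly, AlgHom.comp_apply,
    starHom_starHom]

theorem starPoly_eq_sum (G : SimpleGraph V) :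
    starPoly G = ∑ A ∈ G.edgeFinset.powerset, (-1) ^ #A *
      ∏ S ∈ comps (SimpleGraph.fromEdgeSet (A : Set (Sym2 V))),
        iterDiff MvPolynomial.X (#S - 1) 0 := by
  simp only [starPoly, powerSumPoly, map_sum, map_mul, map_pow, map_neg, map_one, map_prod,
    starHom_X]

theorem aeval_starPoly {R : Type*} [CommRing R] [Algebra ℚ R] (a : ℕ → R) (G : SimpleGraph V) :
    MvPolynomial.aeval a (starPoly G) = ∑ A ∈ G.edgeFinset.powerset, (-1) ^ #A *
      ∏ S ∈ comps (SimpleGraph.fromEdgeSet (A : Set (Sym2 V))), iterDiff a (#S - 1) 0 := by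
  have h : ∀ t m, MvPolynomial.aeval a (iterDiff (MvPolynomial.X : ℕ → MvPolynomial ℕ ℚ) t m) =
      iterDiff a t m := by
    intro t m
    have := iterDiff_map (MvPolynomial.aeval a : MvPolynomial ℕ ℚ →ₐ[ℚ] R).toRingHom
      MvPolynomial.X t m
    simpa using this
  simp only [starPoly_eq_sum, map_sum, map_mul, map_pow, map_neg, map_one, map_prod, h]

theorem isWeightedHomogeneous_iterDiff (t m : ℕ) :
    MvPolynomial.IsWeightedHomogeneous (fun k : ℕ => k + 1)
      (iterDiff (MvPolynomial.X : ℕ → MvPolynomial ℕ ℚ) t m) (t + m + 1) := by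
  induction t generalizing m with
  | zero =>
    have := MvPolynomial.isWeightedHomogeneous_X ℚ (fun k : ℕ => k + 1) m
    simpa [iterDiff] using this
  | succ t ih =>
    rw [iterDiff]
    have h0 := MvPolynomial.isWeightedHomogeneous_X ℚ (fun k : ℕ => k + 1) 0
    have h1 := h0.mul (ih m)
    have h2 := ih (m + 1)
    rw [show 0 + 1 + (t + m + 1) = t + 1 + m + 1 by ring] at h1
    rw [show t + (m + 1) + 1 = t + 1 + m + 1 by ring] at h2
    exact Submodule.sub_mem (MvPolynomial.weightedHomogeneousSubmodule ℚ _ _) h1 h2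

theorem isWeightedHomogeneous_starPoly (G : SimpleGraph V) :
    MvPolynomial.IsWeightedHomogeneous (fun k : ℕ => k + 1) (starPoly G) (Fintype.card V) := by
  rw [starPoly_eq_sum]
  refine Submodule.sum_mem (MvPolynomial.weightedHomogeneousSubmodule ℚ _ _) fun A _ => ?_
  have h1 := MvPolynomial.IsWeightedHomogeneous.prod
    (comps (SimpleGraph.fromEdgeSet (A : Set (Sym2 V))))
    (fun S => iterDiff (MvPolynomial.X : ℕ → MvPolynomial ℕ ℚ) (#S - 1) 0) (fun S => #S)
    (w := fun k : ℕ => k + 1) (by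
      intro S hS
      have := isWeightedHomogeneous_iterDiff (#S - 1) 0
      rwa [show #S - 1 + 0 + 1 = #S by have := card_pos_of_mem_comps hS; omega] at this)
  rw [sum_card_comps] at h1
  rw [show ((-1 : MvPolynomial ℕ ℚ) ^ #A) = MvPolynomial.C ((-1) ^ #A) by simp,
    ← MvPolynomial.smul_eq_C_mul]
  exact Submodule.smul_mem (MvPolynomial.weightedHomogeneousSubmodule ℚ _ _) _ h1

/-- The exponent vector of the monomial which stands for `st_λ`. -/
noncomputable def partExp {n : ℕ} (lam : n.Partition) : ℕ →₀ ℕ :=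
  Multiset.toFinsupp (lam.parts.map Nat.pred)

theorem map_succ_toMultiset_partExp {n : ℕ} (lam : n.Partition) :
    (Finsupp.toMultiset (partExp lam)).map Nat.succ = lam.parts := by
  rw [partExp, Multiset.toFinsupp_toMultiset, Multiset.map_map]
  conv_rhs => rw [← Multiset.map_id lam.parts]
  refine Multiset.map_congr rfl fun k hk => ?_
  exact Nat.succ_pred (lam.parts_pos hk).ne'

theorem partExp_injective {n : ℕ} : Function.Injective (partExp (n := n)) := by
  intro lam mu h
  apply Nat.Partition.ext
  rw [← map_succ_toMultiset_partExp, h, map_succ_toMultiset_partExp]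

theorem exists_partExp_eq {n : ℕ} (d : ℕ →₀ ℕ) (hd : Finsupp.weight (fun k : ℕ => k + 1) d = n) :
    ∃ lam : n.Partition, partExp lam = d := by
  refine ⟨⟨(Finsupp.toMultiset d).map Nat.succ, ?_, ?_⟩, ?_⟩
  · intro i hi
    obtain ⟨k, -, rfl⟩ := Multiset.mem_map.1 hi
    exact Nat.succ_pos k
  · rw [← hd, Finsupp.weight_apply, Finsupp.toMultiset_map, Finsupp.sum_toMultiset,
      Finsupp.sum_mapDomain_index (by simp) (by intros; ring)]
  · simp [partExp, Multiset.map_map]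

theorem starSeriesHom_monomial_partExp {n : ℕ} (lam : n.Partition) :
    starSeriesHom (MvPolynomial.monomial (partExp lam) 1) = starSymm lam := by
  have h1 : MvPolynomial.monomial (partExp lam) (1 : ℚ) =
      ((Finsupp.toMultiset (partExp lam)).map MvPolynomial.X).prod := by
    rw [Finsupp.toMultiset_map, Finsupp.prod_toMultiset,
      Finsupp.prod_mapDomain_index (by simp) (fun _ _ _ => pow_add _ _ _),
      MvPolynomial.monomial_eq, map_one, one_mul]
  rw [h1, map_multiset_prod, Multiset.map_map, starSymm, ← map_succ_toMultiset_partExp,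
    Multiset.map_map]
  congr 1
  refine Multiset.map_congr rfl fun k _ => ?_
  exact starSeriesHom_X k

/-- Injectivity of `starSeriesHom` moves the comparison into the polynomial ring. Exponents that are
not partitions of `n` have coefficient 0 on both sides by homogeneity. -/
theorem isStarExpansion_iff {G : SimpleGraph V} {a : (Fintype.card V).Partition → ℚ} :
    IsStarExpansion G a ↔ ∀ lam, a lam = (starPoly G).coeff (partExp lam) := by
  have h1 : ∑ lam, a lam • starSymm lam =
      starSeriesHom (∑ lam, MvPolynomial.monomial (partExp lam) (a lam)) := by
    rw [map_sum]
    refine Finset.sum_congr rfl fun lam _ => ?_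
    rw [← starSeriesHom_monomial_partExp, ← map_smul, MvPolynomial.smul_monomial, smul_eq_mul,
      mul_one]
  have h2 : ∀ mu : (Fintype.card V).Partition,
      (∑ lam, MvPolynomial.monomial (partExp lam) (a lam)).coeff (partExp mu) = a mu := by
    intro mu
    rw [MvPolynomial.coeff_sum, Finset.sum_eq_single mu]
    · rw [MvPolynomial.coeff_monomial, if_pos rfl]
    · intro lam _ h
      rw [MvPolynomial.coeff_monomial, if_neg fun h' => h (partExp_injective h')]
    · simp
  rw [IsStarExpansion, h1, ← starSeriesHom_starPoly, starSeriesHom_injective.eq_iff]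
  constructor
  · intro h lam
    rw [h, h2]
  · intro h
    ext d
    by_cases hd : Finsupp.weight (fun k : ℕ => k + 1) d = Fintype.card V
    · obtain ⟨mu, rfl⟩ := exists_partExp_eq d hd
      rw [h2, h]
    · rw [(isWeightedHomogeneous_starPoly G).coeff_eq_zero d hd, MvPolynomial.coeff_sum,
        Finset.sum_eq_zero]
      intro lam _
      rw [MvPolynomial.coeff_monomial, if_neg]
      rintro rfl
      apply hd
      have h3 := lam.parts_sum
      conv_lhs at h3 => rw [← map_succ_toMultiset_partExp lam]
      rw [Finsupp.toMultiset_map, Finsupp.sum_toMultiset,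
        Finsupp.sum_mapDomain_index (by simp) (by intros; ring)] at h3
      rw [Finsupp.weight_apply]
      exact h3

end StarExpansion

/-! ### Two univariate specializations of the star-expansion -/

section Specializations
open scoped Classical
open Finset Polynomial

variable {V : Type*} [Fintype V]

/-- The signed count `∑_A (-1)^|A| (1 - X)^(rank A)` of the spanning subgraphs. -/
noncomputable def rankPoly (G : SimpleGraph V) : ℚ[X] :=
  ∑ A ∈ G.edgeFinset.powerset, (-1) ^ #A *
    (1 - X) ^ (Fintype.card V - #(comps (SimpleGraph.fromEdgeSet (A : Set (Sym2 V)))))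

/-- The signed count `∑_A (-1)^|A| ∑_C (1 - X)^(|C| - 1)` of the components of the spanning
subgraphs. -/
noncomputable def componentPoly (G : SimpleGraph V) : ℚ[X] :=
  ∑ A ∈ G.edgeFinset.powerset, (-1) ^ #A *
    ∑ S ∈ comps (SimpleGraph.fromEdgeSet (A : Set (Sym2 V))), (1 - X) ^ (#S - 1)

theorem iterDiff_pow {R : Type*} [CommRing R] (x : R) (t m : ℕ) :
    iterDiff (fun k => x ^ k) t m = x ^ m * (1 - x) ^ t := by
  induction t generalizing m with
  | zero => simp [iterDiff]
  | succ t ih =>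
    rw [iterDiff, ih, ih]
    ring

theorem sum_card_sub_one_comps (H : SimpleGraph V) :
    ∑ S ∈ comps H, (#S - 1) = Fintype.card V - #(comps H) := by
  have h : ∑ S ∈ comps H, (#S - 1) + ∑ S ∈ comps H, 1 = Fintype.card V := by
    rw [← Finset.sum_add_distrib, ← sum_card_comps H]
    refine Finset.sum_congr rfl fun S hS => ?_
    have := card_pos_of_mem_comps hS
    omega
  rw [Finset.sum_const, smul_eq_mul, mul_one] at h
  omega

theorem card_comps_le (H : SimpleGraph V) : #(comps H) ≤ Fintype.card V := by
  rw [← sum_card_comps H, Finset.card_eq_sum_ones]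
  exact Finset.sum_le_sum fun S hS => card_pos_of_mem_comps hS

/-- A component `S` becomes `(1 - X)^(#S - 1)`, and these exponents add up to the rank. -/
theorem aeval_pow_starPoly (G : SimpleGraph V) :
    MvPolynomial.aeval (fun k => (X : ℚ[X]) ^ k) (starPoly G) = rankPoly G := by
  rw [aeval_starPoly, rankPoly]
  refine Finset.sum_congr rfl fun A _ => ?_
  rw [← sum_card_sub_one_comps, ← Finset.prod_pow_eq_pow_sum]
  simp only [iterDiff_pow, pow_zero, one_mul]

theorem coeff_rankPoly (G : SimpleGraph V) (j : ℕ) :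
    (rankPoly G).coeff j =
      ∑ d ∈ (starPoly G).support with Finsupp.weight (fun k : ℕ => k) d = j,
        (starPoly G).coeff d := by
  rw [← aeval_pow_starPoly, Finset.sum_filter]
  conv_lhs => rw [(starPoly G).as_sum]
  rw [map_sum, finsetSum_coeff]
  refine Finset.sum_congr rfl fun d _ => ?_
  rw [MvPolynomial.aeval_monomial]
  have h1 : (d.prod fun k m => ((X : ℚ[X]) ^ k) ^ m) = X ^ (Finsupp.weight (fun k : ℕ => k) d) := by
    rw [Finsupp.weight_apply, Finsupp.prod, Finsupp.sum, ← Finset.prod_pow_eq_pow_sum]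
    refine Finset.prod_congr rfl fun k _ => ?_
    rw [← pow_mul, smul_eq_mul, mul_comm]
  rw [h1, Polynomial.algebraMap_eq, coeff_C_mul, coeff_X_pow]
  simp [eq_comm]

/-- The coefficient of the `k`-th variable in the linear part at the point `(1, 0, 0, …)`. -/
noncomputable def linearCoeff (k : ℕ) (q : MvPolynomial ℕ ℚ) : ℚ :=
  MvPolynomial.eval (fun j => if j = 0 then 1 else 0) (MvPolynomial.pderiv k q)

theorem linearCoeff_mul (k : ℕ) (p q : MvPolynomial ℕ ℚ) :
    linearCoeff k (p * q) = linearCoeff k p * MvPolynomial.eval (fun j => if j = 0 then 1 else 0) q +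
      MvPolynomial.eval (fun j => if j = 0 then 1 else 0) p * linearCoeff k q := by
  rw [linearCoeff, linearCoeff, linearCoeff, Derivation.leibniz, map_add, smul_eq_mul, smul_eq_mul,
    map_mul, map_mul]
  ring

theorem linearCoeff_prod (k : ℕ) {α : Type*} (s : Finset α) (f : α → MvPolynomial ℕ ℚ)
    (hf : ∀ i ∈ s, MvPolynomial.eval (fun j => if j = 0 then 1 else 0) (f i) = 1) :
    linearCoeff k (∏ i ∈ s, f i) = ∑ i ∈ s, linearCoeff k (f i) := by
  induction s using Finset.induction_on with
  | empty => simp [linearCoeff]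
  | insert x s hx ih =>
    rw [prod_insert hx, sum_insert hx, linearCoeff_mul, ih fun i hi => hf i (mem_insert_of_mem hi),
      hf x (mem_insert_self x s), map_prod,
      Finset.prod_eq_one fun i hi => hf i (mem_insert_of_mem hi)]
    ring

theorem eval_iterDiff (t m : ℕ) :
    MvPolynomial.eval (fun j => if j = 0 then 1 else 0)
      (iterDiff (MvPolynomial.X : ℕ → MvPolynomial ℕ ℚ) t m) = if m = 0 then (1 : ℚ) else 0 := by
  induction t generalizing m with
  | zero => simp [iterDiff]
  | succ t ih => simp [iterDiff, ih]

/-- For `k ≠ 0` the multiplier `X 0` acts as the constant 1, so the linearized recursion is that of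
`X^m (1 - X)^t`. -/
theorem linearCoeff_iterDiff {k : ℕ} (hk : k ≠ 0) (t m : ℕ) :
    linearCoeff k (iterDiff (MvPolynomial.X : ℕ → MvPolynomial ℕ ℚ) t m) =
      ((X : ℚ[X]) ^ m * (1 - X) ^ t).coeff k := by
  induction t generalizing m with
  | zero =>
    simp only [iterDiff, linearCoeff, pow_zero, mul_one, coeff_X_pow]
    rw [MvPolynomial.pderiv_X]
    by_cases h : m = k
    · subst h; simp
    · rw [Pi.single_eq_of_ne h, map_zero, if_neg (Ne.symm h)]
  | succ t ih =>
    have h0 : linearCoeff k (MvPolynomial.X 0) = 0 := by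
      rw [linearCoeff, MvPolynomial.pderiv_X, Pi.single_eq_of_ne hk.symm, map_zero]
    have h1 : linearCoeff k (iterDiff (MvPolynomial.X : ℕ → MvPolynomial ℕ ℚ) (t + 1) m) =
        linearCoeff k (MvPolynomial.X 0 * iterDiff MvPolynomial.X t m) -
          linearCoeff k (iterDiff MvPolynomial.X t (m + 1)) := by
      rw [iterDiff, linearCoeff, map_sub, map_sub]
      rfl
    rw [h1, linearCoeff_mul, h0, ih, ih, zero_mul, zero_add, MvPolynomial.eval_X, if_pos rfl,
      one_mul, ← coeff_sub]
    congr 1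
    ring

/-- At `(1, 0, 0, …)` the factor of every component has value 1, so the Leibniz rule turns the
product over components into a sum. -/
theorem linearCoeff_starPoly (G : SimpleGraph V) {k : ℕ} (hk : k ≠ 0) :
    linearCoeff k (starPoly G) = (componentPoly G).coeff k := by
  rw [starPoly_eq_sum, componentPoly, finsetSum_coeff, linearCoeff, map_sum, map_sum]
  refine Finset.sum_congr rfl fun A _ => ?_
  have h1 := linearCoeff_prod k (comps (SimpleGraph.fromEdgeSet (A : Set (Sym2 V))))
    (fun S => iterDiff MvPolynomial.X (#S - 1) 0) fun S _ => by rw [eval_iterDiff, if_pos rfl]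
  rw [Finset.sum_congr rfl fun S _ => linearCoeff_iterDiff hk (#S - 1) 0] at h1
  rw [show ((-1 : ℚ[X]) ^ #A) = C ((-1) ^ #A) by simp, coeff_C_mul, finsetSum_coeff]
  rw [show ((-1 : MvPolynomial ℕ ℚ) ^ #A) = MvPolynomial.C ((-1) ^ #A) by simp,
    MvPolynomial.pderiv_C_mul, map_mul, MvPolynomial.eval_C]
  congr 1
  simp only [pow_zero, one_mul] at h1
  exact h1

/-- Only `X_k` times a power of `X_0` survives differentiation and evaluation; the degree `n`
determines that power. -/
theorem linearCoeff_of_isWeightedHomogeneous {n k : ℕ} (hk : k ≠ 0) (hkn : k < n)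
    {q : MvPolynomial ℕ ℚ}
    (hq : MvPolynomial.IsWeightedHomogeneous (fun k : ℕ => k + 1) q n) :
    linearCoeff k q = q.coeff (Finsupp.single k 1 + Finsupp.single 0 (n - 1 - k)) := by
  have h1 : linearCoeff k q = ∑ d ∈ q.support, q.coeff d *
      if d = Finsupp.single k 1 + Finsupp.single 0 (n - 1 - k) then 1 else 0 := by
    rw [linearCoeff]
    conv_lhs => rw [q.as_sum]
    rw [map_sum, map_sum]
    refine Finset.sum_congr rfl fun d hd => ?_
    rw [MvPolynomial.pderiv_monomial, MvPolynomial.eval_monomial, mul_assoc]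
    congr 1
    split_ifs with h
    · subst h
      rw [add_tsub_cancel_left, Finsupp.prod_single_index (by simp)]
      simp [hk.symm]
    · by_cases hdk : d k = 0
      · rw [hdk, Nat.cast_zero, zero_mul]
      by_cases h2 : ∃ j ≠ 0, (d - Finsupp.single k 1 : ℕ →₀ ℕ) j ≠ 0
      · obtain ⟨j, hj0, hj⟩ := h2
        rw [Finsupp.prod, Finset.prod_eq_zero (Finsupp.mem_support_iff.2 hj), mul_zero]
        rw [if_neg hj0, zero_pow hj]
      · exfalso
        push Not at h2
        apply h
        have h3 : d = Finsupp.single k 1 + Finsupp.single 0 (d 0) := by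
          ext j
          by_cases hj0 : j = 0
          · subst hj0
            simp [hk]
          · have := h2 j hj0
            rw [Finsupp.tsub_apply] at this
            rw [Finsupp.add_apply, Finsupp.single_eq_of_ne (a := 0) hj0, add_zero]
            by_cases hjk : j = k
            · subst hjk
              rw [Finsupp.single_eq_same] at this ⊢
              omega
            · rw [Finsupp.single_eq_of_ne hjk] at this ⊢
              exact this
        have h4 := hq (MvPolynomial.mem_support_iff.1 hd)
        rw [h3, map_add, Finsupp.weight_single, Finsupp.weight_single] at h4
        simp only [smul_eq_mul, one_mul, zero_add, mul_one] at h4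
        rw [h3]
        congr 2
        omega
  rw [h1]
  simp only [mul_ite, mul_one, mul_zero, Finset.sum_ite_eq']
  split_ifs with h
  · rfl
  · exact (MvPolynomial.notMem_support_iff.1 h).symm

theorem coeff_hook_starPoly (G : SimpleGraph V) {k : ℕ} (hk : k ≠ 0) (hkn : k < Fintype.card V) :
    (starPoly G).coeff (Finsupp.single k 1 + Finsupp.single 0 (Fintype.card V - 1 - k)) =
      (componentPoly G).coeff k := by
  rw [← linearCoeff_starPoly G hk,
    linearCoeff_of_isWeightedHomogeneous hk hkn (isWeightedHomogeneous_starPoly G)]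

theorem coeff_one_sub_X_pow (m k : ℕ) :
    ((1 - X : ℚ[X]) ^ m).coeff k = (-1) ^ k * (m.choose k : ℚ) := by
  have h : (1 - X : ℚ[X]) ^ m = ((1 + X) ^ m).comp (C (-1) * X) := by
    simp [sub_eq_add_neg]
  rw [h, comp_C_mul_X_coeff, coeff_one_add_X_pow, mul_comm]

/-- Handles the index not covered by the hook formula: termwise, the number of components is `n`
minus the rank, and the rank is minus the linear coefficient of `(1 - X)^rank`. -/
theorem componentPoly_coeff_zero (G : SimpleGraph V) :
    (componentPoly G).coeff 0 = (rankPoly G).coeff 1 + Fintype.card V * (rankPoly G).coeff 0 := by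
  rw [componentPoly, rankPoly, finsetSum_coeff, finsetSum_coeff, finsetSum_coeff,
    Finset.mul_sum, ← Finset.sum_add_distrib]
  refine Finset.sum_congr rfl fun A _ => ?_
  rw [show ((-1 : ℚ[X]) ^ #A) = C ((-1) ^ #A) by simp, coeff_C_mul, coeff_C_mul, coeff_C_mul,
    finsetSum_coeff]
  simp only [coeff_one_sub_X_pow]
  have hle := card_comps_le (SimpleGraph.fromEdgeSet (A : Set (Sym2 V)))
  simp
  rw [Nat.cast_sub hle]
  ring

end Specializations

/-! ### Spanning subgraphs of a unicyclic graph -/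

section Unicyclic
open scoped Classical
open Finset

/-- `φ` parametrizes a cycle of order `c` of the connected graph `G`, and each edge of this cycle
lies on every cycle of `G`. -/
structure IsUnicyclicWith {V : Type*} (G : SimpleGraph V) (c : ℕ) (φ : Fin c → V) : Prop where
  connected : G.Connected
  three_le : 3 ≤ c
  injective : Function.Injective φ
  adj : ∀ i j, (SimpleGraph.cycleGraph c).Adj i j → G.Adj (φ i) (φ j)
  unique : ∀ k, 3 ≤ k → ∀ f : SimpleGraph.Copy (SimpleGraph.cycleGraph k) G, ∀ i j,
    (SimpleGraph.cycleGraph c).Adj i j →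
      ∃ i' j', (SimpleGraph.cycleGraph k).Adj i' j' ∧ f i' = φ i ∧ f j' = φ j

theorem exists_isUnicyclicWith {V : Type*} {G : SimpleGraph V} (hG : IsConnectedUnicyclic G)
    {c : ℕ} (hc : HasCycleOfOrder G c) : ∃ φ, IsUnicyclicWith G c φ := by
  obtain ⟨H, h3, ⟨e⟩⟩ := hc
  obtain ⟨hconn, H0, -, huniq⟩ := hG
  have hH : H = H0 := huniq H ⟨c, h3, ⟨e⟩⟩
  refine ⟨fun i => (e.symm i).1, hconn, h3, ?_, ?_, ?_⟩
  · intro i j hij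
    exact e.symm.injective (Subtype.ext hij)
  · intro i j hij
    exact H.adj_sub (e.symm.map_adj_iff.2 hij)
  · intro k hk f i j hij
    have h1 : f.toSubgraph = H := by
      rw [hH]
      exact huniq _ ⟨k, hk, ⟨f.isoToSubgraph.symm⟩⟩
    have h2 : H.Adj (e.symm i).1 (e.symm j).1 := e.symm.map_adj_iff.2 hij
    have h3 : f.toSubgraph.Adj (e.symm i).1 (e.symm j).1 := h1.symm ▸ h2
    simp only [SimpleGraph.Copy.toSubgraph, SimpleGraph.Subgraph.map_adj, Relation.Map] at h3
    obtain ⟨a, b, hab, ha, hb⟩ := h3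
    exact ⟨a, b, hab, ha, hb⟩

variable {V : Type*} [Fintype V]

theorem card_comps_insert_of_not_reachable {A : Finset (Sym2 V)} {x y : V}
    (h : ¬ (SimpleGraph.fromEdgeSet (A : Set (Sym2 V))).Reachable x y) :
    #(comps (SimpleGraph.fromEdgeSet ((insert s(x, y) A : Finset _) : Set (Sym2 V)))) + 1 =
      #(comps (SimpleGraph.fromEdgeSet (A : Set (Sym2 V)))) := by
  set H := SimpleGraph.fromEdgeSet (A : Set (Sym2 V)) with hH
  set H' := SimpleGraph.fromEdgeSet ((insert s(x, y) A : Finset _) : Set (Sym2 V)) with hH'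
  have hle : H ≤ H' := SimpleGraph.fromEdgeSet_mono (by simp)
  have hxy : H'.Adj x y := by
    rw [hH', SimpleGraph.fromEdgeSet_adj]
    refine ⟨by simp, ?_⟩
    rintro rfl
    exact h (SimpleGraph.Reachable.refl x)
  have hadj : ∀ a b, H'.Adj a b → H.Adj a b ∨ (a = x ∧ b = y) ∨ (a = y ∧ b = x) := by
    intro a b hab
    rw [hH', SimpleGraph.fromEdgeSet_adj, mem_coe, mem_insert, Sym2.eq_iff] at hab
    rcases hab.1 with h1 | h1
    · exact Or.inr h1
    · exact Or.inl ((SimpleGraph.fromEdgeSet_adj _).2 ⟨h1, hab.2⟩)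
  have hx' : compOf H' x = compOf H x ∪ compOf H y := by
    refine compOf_eq (mem_union_left _ (self_mem_compOf H x)) ?_ ?_
    · intro a ha b hab
      rcases hadj a b hab with h1 | h1 | h1
      · rcases mem_union.1 ha with h2 | h2
        · exact mem_union_left _ (mem_compOf.2 ((mem_compOf.1 h2).trans h1.reachable))
        · exact mem_union_right _ (mem_compOf.2 ((mem_compOf.1 h2).trans h1.reachable))
      · rw [h1.2]
        exact mem_union_right _ (self_mem_compOf H y)
      · rw [h1.2]
        exact mem_union_left _ (self_mem_compOf H x)
    · intro w hw
      rcases mem_union.1 hw with h2 | h2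
      · exact (mem_compOf.1 h2).mono hle
      · exact hxy.reachable.trans ((mem_compOf.1 h2).mono hle)
  have hw' : ∀ w, x ∉ compOf H w → y ∉ compOf H w → compOf H' w = compOf H w := by
    intro w hwx hwy
    refine compOf_eq (self_mem_compOf H w) ?_ fun a ha => (mem_compOf.1 ha).mono hle
    intro a ha b hab
    rcases hadj a b hab with h1 | h1 | h1
    · exact mem_compOf.2 ((mem_compOf.1 ha).trans h1.reachable)
    · exact absurd (h1.1 ▸ ha) hwx
    · exact absurd (h1.1 ▸ ha) hwy
  have hne : compOf H x ≠ compOf H y := fun h1 => h (compOf_eq_compOf_iff.1 h1)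
  have heq : comps H' = insert (compOf H x ∪ compOf H y)
      (((comps H).erase (compOf H x)).erase (compOf H y)) := by
    ext T
    rw [mem_insert, mem_erase, mem_erase]
    constructor
    · intro hT
      obtain ⟨w, rfl⟩ := mem_comps_iff.1 hT
      by_cases h1 : x ∈ compOf H w
      · left
        rw [← hx', compOf_eq_compOf_iff]
        exact (mem_compOf.1 h1).mono hle
      by_cases h2 : y ∈ compOf H w
      · left
        rw [← hx', compOf_eq_compOf_iff]
        exact ((mem_compOf.1 h2).mono hle).trans hxy.symm.reachable
      · right
        rw [hw' w h1 h2]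
        refine ⟨?_, ?_, compOf_mem_comps H w⟩
        · rintro h3
          exact h2 (h3 ▸ self_mem_compOf H y)
        · rintro h3
          exact h1 (h3 ▸ self_mem_compOf H x)
    · rintro (rfl | ⟨h1, h2, h3⟩)
      · rw [← hx']
        exact compOf_mem_comps _ _
      · obtain ⟨w, rfl⟩ := mem_comps_iff.1 h3
        rw [← hw' w]
        · exact compOf_mem_comps _ _
        · exact fun h4 => h2 (eq_compOf_of_mem h3 h4)
        · exact fun h4 => h1 (eq_compOf_of_mem h3 h4)
  have hnot : compOf H x ∪ compOf H y ∉ ((comps H).erase (compOf H x)).erase (compOf H y) := by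
    intro h1
    have h2 := mem_of_mem_erase (mem_of_mem_erase h1)
    have h3 := eq_compOf_of_mem h2 (mem_union_left _ (self_mem_compOf H x))
    exact (mem_erase.1 (mem_of_mem_erase h1)).1 h3
  rw [heq, card_insert_of_notMem hnot,
    card_erase_of_mem (mem_erase.2 ⟨hne.symm, compOf_mem_comps H y⟩),
    card_erase_of_mem (compOf_mem_comps H x)]
  have : 1 < #(comps H) :=
    one_lt_card.2 ⟨_, compOf_mem_comps H x, _, compOf_mem_comps H y, hne⟩
  omega

theorem comps_insert_of_reachable {A : Finset (Sym2 V)} {x y : V}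
    (h : (SimpleGraph.fromEdgeSet (A : Set (Sym2 V))).Reachable x y) :
    comps (SimpleGraph.fromEdgeSet ((insert s(x, y) A : Finset _) : Set (Sym2 V))) =
      comps (SimpleGraph.fromEdgeSet (A : Set (Sym2 V))) := by
  have : ∀ w, compOf (SimpleGraph.fromEdgeSet ((insert s(x, y) A : Finset _) : Set (Sym2 V))) w =
      compOf (SimpleGraph.fromEdgeSet (A : Set (Sym2 V))) w := by
    intro w
    refine compOf_eq (self_mem_compOf _ w) ?_
      fun a ha => (mem_compOf.1 ha).mono (SimpleGraph.fromEdgeSet_mono (by simp))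
    intro a ha b hab
    rw [SimpleGraph.fromEdgeSet_adj, mem_coe, mem_insert, Sym2.eq_iff] at hab
    rw [mem_compOf] at ha ⊢
    rcases hab.1 with (⟨rfl, rfl⟩ | ⟨rfl, rfl⟩) | h1
    · exact ha.trans h
    · exact ha.trans h.symm
    · exact ha.trans (SimpleGraph.Adj.reachable ((SimpleGraph.fromEdgeSet_adj _).2 ⟨h1, hab.2⟩))
  ext T
  simp only [mem_comps_iff, this]

theorem fromEdgeSet_insert {V : Type*} (A : Finset (Sym2 V)) (x y : V) :
    SimpleGraph.fromEdgeSet ((insert s(x, y) A : Finset _) : Set (Sym2 V)) =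
      SimpleGraph.fromEdgeSet (A : Set (Sym2 V)) ⊔ SimpleGraph.edge x y := by
  rw [coe_insert, Set.insert_eq, SimpleGraph.edge, Set.union_comm, SimpleGraph.fromEdgeSet_union]

theorem card_comps_add_card_of_isAcyclic {A : Finset (Sym2 V)} (hd : ∀ e ∈ A, ¬ e.IsDiag)
    (h : (SimpleGraph.fromEdgeSet (A : Set (Sym2 V))).IsAcyclic) :
    #(comps (SimpleGraph.fromEdgeSet (A : Set (Sym2 V)))) + #A = Fintype.card V := by
  induction A using Finset.induction_on with
  | empty =>
    have : ∀ v, compOf (SimpleGraph.fromEdgeSet ((∅ : Finset (Sym2 V)) : Set (Sym2 V))) v = {v} := by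
      intro v
      refine compOf_eq (mem_singleton_self v) (fun a _ b hab => by simp at hab) fun w hw => ?_
      rw [mem_singleton.1 hw]
    rw [comps, card_image_of_injective, card_univ, card_empty, add_zero]
    intro v w hvw
    rw [this, this] at hvw
    simpa using hvw
  | insert e A he ih =>
    induction e with
    | h x y =>
      rw [fromEdgeSet_insert, SimpleGraph.isAcyclic_sup_fromEdgeSet_iff] at h
      have hxy : ¬ (SimpleGraph.fromEdgeSet (A : Set (Sym2 V))).Reachable x y := by
        intro hr
        rcases h.2 hr with h1 | h1
        · exact hd s(x, y) (mem_insert_self _ _) (by simpa using h1)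
        · exact he ((SimpleGraph.fromEdgeSet_adj _).1 h1).1
      rw [card_insert_of_notMem he, ← ih (fun e he => hd e (mem_insert_of_mem he)) h.1,
        ← card_comps_insert_of_not_reachable hxy]
      ring

/-- The edges of the cycle parametrized by `φ`. -/
noncomputable def cycleEdges {V : Type*} {c : ℕ} (φ : Fin c → V) : Finset (Sym2 V) :=
  (SimpleGraph.cycleGraph c).edgeFinset.image (Sym2.map φ)

namespace IsUnicyclicWith

variable {G : SimpleGraph V} {c : ℕ} {φ : Fin c → V}

theorem mem_cycleEdges {V : Type*} {c : ℕ} {φ : Fin c → V} {i j : Fin c}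
    (h : (SimpleGraph.cycleGraph c).Adj i j) : s(φ i, φ j) ∈ cycleEdges φ :=
  mem_image.2 ⟨s(i, j), SimpleGraph.mem_edgeFinset.2 h, rfl⟩

theorem cycleEdges_subset (h : IsUnicyclicWith G c φ) : cycleEdges φ ⊆ G.edgeFinset := by
  intro e he
  obtain ⟨e', he', rfl⟩ := mem_image.1 he
  induction e' with
  | h i j =>
    have hij := SimpleGraph.mem_edgeFinset.1 he'
    simpa using h.adj i j hij

theorem card_cycleEdges {V : Type*} {G : SimpleGraph V} {c : ℕ} {φ : Fin c → V}
    (h : IsUnicyclicWith G c φ) : #(cycleEdges φ) = c := by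
  rw [cycleEdges, card_image_of_injective _ (Sym2.map.injective h.injective)]
  obtain ⟨m, rfl⟩ : ∃ m, c = m + 3 := ⟨c - 3, by have := h.three_le; omega⟩
  have h1 := (SimpleGraph.cycleGraph (m + 3)).sum_degrees_eq_twice_card_edges
  have h2 : ∀ v, (SimpleGraph.cycleGraph (m + 3)).degree v = 2 := by
    intro v
    rw [← SimpleGraph.cycleGraph_degree_three_le (v := v)]
  simp only [h2, Finset.sum_const, card_univ, Fintype.card_fin, smul_eq_mul] at h1
  have h3 : #(SimpleGraph.cycleGraph (m + 3)).edgeFinset = m + 3 := by omega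
  convert h3

/-- A cycle of the spanning subgraph is a cycle of `G`, hence passes through every edge of the given
one. -/
theorem isAcyclic (h : IsUnicyclicWith G c φ) {A : Finset (Sym2 V)} (hA : A ⊆ G.edgeFinset)
    (hn : ¬ cycleEdges φ ⊆ A) : (SimpleGraph.fromEdgeSet (A : Set (Sym2 V))).IsAcyclic := by
  rw [SimpleGraph.isAcyclic_iff_free_cycleGraph]
  rintro k hk ⟨f⟩
  apply hn
  have hle : SimpleGraph.fromEdgeSet (A : Set (Sym2 V)) ≤ G := by
    intro x y hxy
    simpa using hA ((SimpleGraph.fromEdgeSet_adj _).1 hxy).1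
  intro e he
  obtain ⟨e', he', rfl⟩ := mem_image.1 he
  induction e' with
  | h i j =>
    have hij := SimpleGraph.mem_edgeFinset.1 he'
    obtain ⟨i', j', hij', hi, hj⟩ :=
      h.unique k hk ((SimpleGraph.Copy.ofLE _ _ hle).comp f) i j hij
    have h1 := f.toHom.map_adj hij'
    have h2 := ((SimpleGraph.fromEdgeSet_adj _).1 h1).1
    have hi' : f i' = φ i := hi
    have hj' : f j' = φ j := hj
    rw [Sym2.map_mk, ← hi', ← hj']
    exact h2

theorem not_isAcyclic {V : Type*} {G : SimpleGraph V} {c : ℕ} {φ : Fin c → V}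
    (h : IsUnicyclicWith G c φ) {A : Finset (Sym2 V)}
    (hA : cycleEdges φ ⊆ A) : ¬ (SimpleGraph.fromEdgeSet (A : Set (Sym2 V))).IsAcyclic := by
  rw [SimpleGraph.isAcyclic_iff_free_cycleGraph]
  intro h1
  refine h1 c h.three_le ⟨⟨⟨φ, ?_⟩, h.injective⟩⟩
  intro i j hij
  rw [SimpleGraph.fromEdgeSet_adj]
  exact ⟨hA (mem_cycleEdges hij), fun h2 => hij.ne (h.injective h2)⟩

theorem not_isDiag {A : Finset (Sym2 V)} (hA : A ⊆ G.edgeFinset) : ∀ e ∈ A, ¬ e.IsDiag :=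
  fun _ he => G.not_isDiag_of_mem_edgeFinset (hA he)

theorem card_comps_of_not_subset (h : IsUnicyclicWith G c φ) {A : Finset (Sym2 V)}
    (hA : A ⊆ G.edgeFinset) (hn : ¬ cycleEdges φ ⊆ A) :
    #(comps (SimpleGraph.fromEdgeSet (A : Set (Sym2 V)))) + #A = Fintype.card V :=
  card_comps_add_card_of_isAcyclic (not_isDiag hA) (h.isAcyclic hA hn)

/-- Deleting a cycle edge leaves a forest with the same components: were its ends separated there,
putting it back would still give a forest. -/
theorem card_comps_of_subset (h : IsUnicyclicWith G c φ) {A : Finset (Sym2 V)}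
    (hA : A ⊆ G.edgeFinset) (hs : cycleEdges φ ⊆ A) :
    #(comps (SimpleGraph.fromEdgeSet (A : Set (Sym2 V)))) + #A = Fintype.card V + 1 := by
  obtain ⟨e, he⟩ : (cycleEdges φ).Nonempty := by
    rw [← card_pos, h.card_cycleEdges]
    have := h.three_le
    omega
  have heA : e ∈ A := hs he
  have hA' : A.erase e ⊆ G.edgeFinset := (erase_subset _ _).trans hA
  have hn : ¬ cycleEdges φ ⊆ A.erase e := fun h1 => notMem_erase e A (h1 he)
  have h1 := h.card_comps_of_not_subset hA' hn
  have h2 := h.not_isAcyclic hs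
  rw [← insert_erase heA] at h2 ⊢
  induction e with
  | h x y =>
    have hr : (SimpleGraph.fromEdgeSet ((A.erase s(x, y) : Finset _) : Set (Sym2 V))).Reachable
        x y := by
      by_contra hr
      apply h2
      rw [fromEdgeSet_insert]
      exact (h.isAcyclic hA' hn).sup_edge_of_not_reachable hr
    rw [comps_insert_of_reachable hr, card_insert_of_notMem (notMem_erase _ _), ← h1]
    ring

theorem card_edgeFinset (h : IsUnicyclicWith G c φ) : #G.edgeFinset = Fintype.card V := by
  have h1 := h.card_comps_of_subset le_rfl h.cycleEdges_subset
  have h2 : #(comps (SimpleGraph.fromEdgeSet (G.edgeFinset : Set (Sym2 V)))) = 1 := by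
    rw [SimpleGraph.coe_edgeFinset, SimpleGraph.fromEdgeSet_edgeSet]
    obtain ⟨v⟩ := h.connected.nonempty
    have h3 : ∀ w, compOf G w = univ := by
      intro w
      ext x
      simp [mem_compOf, h.connected.preconnected w x]
    rw [card_eq_one]
    refine ⟨univ, ?_⟩
    ext T
    rw [mem_comps_iff, mem_singleton]
    exact ⟨fun ⟨w, hw⟩ => hw ▸ h3 w, fun hT => ⟨v, hT ▸ h3 v⟩⟩
  omega

theorem le_card (h : IsUnicyclicWith G c φ) : c ≤ Fintype.card V := by
  have := Fintype.card_le_of_injective φ h.injective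
  rwa [Fintype.card_fin] at this

end IsUnicyclicWith

end Unicyclic

/-! ### Signed counts of spanning subgraphs with a prescribed component -/

section SignedCounts
open scoped Classical
open Finset Polynomial

variable {V : Type*} [Fintype V]

/-- The signed number of spanning subgraphs of `G` which have `S` as a connected component. -/
noncomputable def signedCount (G : SimpleGraph V) (S : Finset V) : ℚ :=
  ∑ A ∈ G.edgeFinset.powerset.filter
    (fun A : Finset (Sym2 V) => S ∈ comps (SimpleGraph.fromEdgeSet (A : Set (Sym2 V)))),
    (-1) ^ #A

theorem componentPoly_eq_sum_signedCount (G : SimpleGraph V) :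
    componentPoly G = ∑ S : Finset V, C (signedCount G S) * (1 - X) ^ (#S - 1) := by
  have h1 : ∀ A : Finset (Sym2 V), ((-1 : ℚ[X]) ^ #A *
      ∑ S ∈ comps (SimpleGraph.fromEdgeSet (A : Set (Sym2 V))), (1 - X) ^ (#S - 1)) =
      ∑ S : Finset V, if S ∈ comps (SimpleGraph.fromEdgeSet (A : Set (Sym2 V))) then
        (-1) ^ #A * (1 - X) ^ (#S - 1) else 0 := by
    intro A
    rw [Finset.mul_sum, ← Finset.sum_filter, Finset.filter_univ_mem]
  rw [componentPoly, Finset.sum_congr rfl fun A _ => h1 A, Finset.sum_comm]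
  refine Finset.sum_congr rfl fun S _ => ?_
  rw [← Finset.sum_filter, ← Finset.sum_mul, signedCount, map_sum]
  congr 1
  refine Finset.sum_congr rfl fun A _ => ?_
  simp

theorem signedCount_empty (G : SimpleGraph V) : signedCount G ∅ = 0 := by
  rw [signedCount, Finset.filter_false_of_mem, Finset.sum_empty]
  intro A _ h
  exact (nonempty_of_mem_comps h).ne_empty rfl

theorem univ_mem_comps_iff [Nonempty V] (H : SimpleGraph V) :
    univ ∈ comps H ↔ #(comps H) = 1 := by
  constructor
  · intro h
    rw [card_eq_one]
    refine ⟨univ, eq_singleton_iff_unique_mem.2 ⟨h, fun T hT => ?_⟩⟩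
    obtain ⟨v, hv⟩ := nonempty_of_mem_comps hT
    rw [eq_compOf_of_mem hT hv, eq_compOf_of_mem h (mem_univ v)]
  · intro h
    obtain ⟨T, hT⟩ := card_eq_one.1 h
    have h1 := sum_card_comps H
    rw [hT, sum_singleton, card_eq_iff_eq_univ] at h1
    rw [hT, h1]
    exact mem_singleton_self _

theorem coeff_rankPoly_card_sub_one [Nonempty V] (G : SimpleGraph V) :
    (rankPoly G).coeff (Fintype.card V - 1) = (-1) ^ (Fintype.card V - 1) * signedCount G univ := by
  rw [rankPoly, finsetSum_coeff, signedCount, Finset.sum_filter, Finset.mul_sum]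
  refine Finset.sum_congr rfl fun A _ => ?_
  rw [show ((-1 : ℚ[X]) ^ #A) = C ((-1) ^ #A) by simp, coeff_C_mul, coeff_one_sub_X_pow]
  have hpos : 0 < #(comps (SimpleGraph.fromEdgeSet (A : Set (Sym2 V)))) := by
    obtain ⟨v⟩ := ‹Nonempty V›
    exact card_pos.2 ⟨_, compOf_mem_comps _ v⟩
  have hle := card_comps_le (SimpleGraph.fromEdgeSet (A : Set (Sym2 V)))
  split_ifs with h
  · rw [univ_mem_comps_iff] at h
    rw [h, Nat.choose_self]
    ring
  · rw [univ_mem_comps_iff] at h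
    rw [Nat.choose_eq_zero_of_lt (by omega)]
    simp

theorem componentPoly_coeff_card_sub_one [Nonempty V] (G : SimpleGraph V) :
    (componentPoly G).coeff (Fintype.card V - 1) =
      (-1) ^ (Fintype.card V - 1) * signedCount G univ := by
  rw [componentPoly_eq_sum_signedCount, finsetSum_coeff, Finset.sum_eq_single univ]
  · rw [coeff_C_mul, coeff_one_sub_X_pow, card_univ, Nat.choose_self]
    ring
  · intro S _ hS
    rw [coeff_C_mul, coeff_one_sub_X_pow]
    rcases S.eq_empty_or_nonempty with rfl | hne
    · rw [signedCount_empty, zero_mul]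
    have h1 := card_lt_univ_of_notMem (s := S)
      (x := (by simpa [Finset.eq_univ_iff_forall] using hS : ∃ x, x ∉ S).choose)
      (by simpa [Finset.eq_univ_iff_forall] using hS : ∃ x, x ∉ S).choose_spec
    have h2 := hne.card_pos
    rw [Nat.choose_eq_zero_of_lt (by omega)]
    simp
  · simp

namespace IsUnicyclicWith

variable {G : SimpleGraph V} {c : ℕ} {φ : Fin c → V}

/-- The rank of `A` is `#A`, less one if `A` contains the cycle. With `#A` throughout, the `n` edges
give `((X - 1) + 1)^n = X^n`; the correction runs over the supersets of the cycle. -/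
theorem rankPoly_eq (h : IsUnicyclicWith G c φ) :
    rankPoly G = X ^ Fintype.card V +
      (-1) ^ c * (X ^ (Fintype.card V - c + 1) * (1 - X) ^ (c - 1)) := by
  -- The correction comes from `(1 - X)^(r - 1) - (1 - X)^r = (1 - X)^(r - 1) * X`.
  have hterm : ∀ A ∈ G.edgeFinset.powerset, (-1 : ℚ[X]) ^ #A *
      (1 - X) ^ (Fintype.card V - #(comps (SimpleGraph.fromEdgeSet (A : Set (Sym2 V))))) =
      (X - 1) ^ #A * 1 ^ (#G.edgeFinset - #A) +
        if cycleEdges φ ⊆ A then (-1) ^ #A * (1 - X) ^ (#A - 1) * X else 0 := by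
    intro A hA
    rw [mem_powerset] at hA
    rw [one_pow, mul_one, show (X - 1 : ℚ[X]) = (-1) * (1 - X) by ring, mul_pow]
    split_ifs with hs
    · have h1 := h.card_comps_of_subset hA hs
      have h2 := card_le_card hs
      rw [h.card_cycleEdges] at h2
      have h3 := h.three_le
      rw [show Fintype.card V - #(comps (SimpleGraph.fromEdgeSet (A : Set (Sym2 V)))) = #A - 1 by
        omega]
      obtain ⟨m, hm⟩ : ∃ m, #A = m + 1 := ⟨#A - 1, by omega⟩
      rw [hm, Nat.add_sub_cancel, pow_succ (1 - X)]
      ring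
    · have h1 := h.card_comps_of_not_subset hA hs
      rw [show Fintype.card V - #(comps (SimpleGraph.fromEdgeSet (A : Set (Sym2 V)))) = #A by
        omega, add_zero]
  rw [rankPoly, Finset.sum_congr rfl hterm, Finset.sum_add_distrib,
    Finset.sum_pow_mul_eq_add_pow, sub_add_cancel, h.card_edgeFinset]
  congr 1
  rw [← Finset.sum_filter]
  have h1 : ∑ A ∈ G.edgeFinset.powerset with cycleEdges φ ⊆ A,
      (-1 : ℚ[X]) ^ #A * (1 - X) ^ (#A - 1) * X =
      ∑ B ∈ (G.edgeFinset \ cycleEdges φ).powerset,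
        (-1 : ℚ[X]) ^ (c + #B) * (1 - X) ^ (c + #B - 1) * X := by
    refine Finset.sum_nbij' (fun A => A \ cycleEdges φ) (fun B => cycleEdges φ ∪ B) ?_ ?_ ?_ ?_ ?_
    · intro A hA
      rw [mem_filter, mem_powerset] at hA
      exact mem_powerset.2 (sdiff_subset_sdiff hA.1 le_rfl)
    · intro B hB
      rw [mem_powerset] at hB
      exact mem_filter.2 ⟨mem_powerset.2 (union_subset h.cycleEdges_subset
        (hB.trans sdiff_subset)), subset_union_left⟩
    · intro A hA
      exact union_sdiff_of_subset (mem_filter.1 hA).2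
    · intro B hB
      rw [mem_powerset] at hB
      rw [union_sdiff_cancel_left]
      exact disjoint_right.2 fun e he => (mem_sdiff.1 (hB he)).2
    · intro A hA
      have hs := (mem_filter.1 hA).2
      have h2 := card_le_card hs
      rw [card_sdiff_of_subset hs, h.card_cycleEdges]
      rw [h.card_cycleEdges] at h2
      rw [Nat.add_sub_cancel' h2]
  have h3 : ∀ B : Finset (Sym2 V), (-1 : ℚ[X]) ^ (c + #B) * (1 - X) ^ (c + #B - 1) * X =
      (-1) ^ c * (1 - X) ^ (c - 1) * X *
        ((X - 1) ^ #B * 1 ^ (#(G.edgeFinset \ cycleEdges φ) - #B)) := by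
    intro B
    rw [one_pow, mul_one, show (X - 1 : ℚ[X]) = (-1) * (1 - X) by ring, mul_pow,
      show c + #B - 1 = c - 1 + #B by have := h.three_le; omega, pow_add, pow_add]
    ring
  rw [h1, Finset.sum_congr rfl fun B _ => h3 B, ← Finset.mul_sum, Finset.sum_pow_mul_eq_add_pow,
    sub_add_cancel, card_sdiff_of_subset h.cycleEdges_subset, h.card_edgeFinset, h.card_cycleEdges]
  ring

theorem coeff_rankPoly_of_le (h : IsUnicyclicWith G c φ) {j : ℕ}
    (hj : j ≤ Fintype.card V - c) : (rankPoly G).coeff j = 0 := by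
  have h1 := h.le_card
  have h3 := h.three_le
  rw [h.rankPoly_eq, show ((-1 : ℚ[X]) ^ c) = C ((-1) ^ c) by simp, coeff_add, coeff_X_pow,
    coeff_C_mul, coeff_X_pow_mul', if_neg (by omega), if_neg (by omega)]
  simp

theorem coeff_rankPoly_succ (h : IsUnicyclicWith G c φ) :
    (rankPoly G).coeff (Fintype.card V - c + 1) = (-1) ^ c := by
  have h1 := h.le_card
  have h3 := h.three_le
  rw [h.rankPoly_eq, show ((-1 : ℚ[X]) ^ c) = C ((-1) ^ c) by simp, coeff_add, coeff_X_pow,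
    coeff_C_mul, coeff_X_pow_mul', if_neg (by omega), if_pos le_rfl, Nat.sub_self,
    coeff_one_sub_X_pow]
  simp

/-- Read off at `X^(n-1)`, where the second summand of `rankPoly_eq` contributes coefficient `c - 2`
of `(1 - X)^(c-1)`, that is `±(c - 1)`. -/
theorem signedCount_univ (h : IsUnicyclicWith G c φ) :
    signedCount G univ = (-1) ^ (Fintype.card V - 1) * ((c : ℚ) - 1) := by
  have h1 := h.le_card
  have h3 := h.three_le
  have := h.connected.nonempty
  have h2 := coeff_rankPoly_card_sub_one G
  rw [h.rankPoly_eq, show ((-1 : ℚ[X]) ^ c) = C ((-1) ^ c) by simp, coeff_add, coeff_X_pow,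
    coeff_C_mul, coeff_X_pow_mul', if_neg (by omega), if_pos (by omega),
    show Fintype.card V - 1 - (Fintype.card V - c + 1) = c - 2 by omega,
    coeff_one_sub_X_pow] at h2
  obtain ⟨m, rfl⟩ : ∃ m, c = m + 2 := ⟨c - 2, by omega⟩
  rw [show m + 2 - 2 = m by omega, show m + 2 - 1 = m + 1 by omega,
    Nat.choose_succ_self_right] at h2
  have h4 : ((-1 : ℚ) ^ (Fintype.card V - 1)) * (-1) ^ (Fintype.card V - 1) = 1 := by
    rw [← mul_pow]; simp
  have h5 : ((-1 : ℚ) ^ m) * (-1) ^ m = 1 := by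
    rw [← mul_pow]; simp
  have h6 : signedCount G univ = (-1) ^ (Fintype.card V - 1) *
      ((-1) ^ (Fintype.card V - 1) * signedCount G univ) := by
    rw [← mul_assoc, h4, one_mul]
  rw [h6, ← h2]
  push_cast
  linear_combination ((-1 : ℚ) ^ (Fintype.card V - 1)) * (m + 1) * h5

theorem coeff_componentPoly_card_sub_one (h : IsUnicyclicWith G c φ) :
    (componentPoly G).coeff (Fintype.card V - 1) = (c : ℚ) - 1 := by
  have := h.connected.nonempty
  rw [componentPoly_coeff_card_sub_one, h.signedCount_univ, ← mul_assoc, ← mul_pow]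
  simp

end IsUnicyclicWith

/-- Small sets drop out, so `(1 - X)^(c-2)` divides `componentPoly` with a quotient of degree at
most `t + 1`. By coprimality `X^(t+1)` divides the quotient, which is thus a scalar multiple of
`X^(t+1)`: leading coefficient and value at 1 coincide. -/
theorem sum_signedCount_of_dvd {G : SimpleGraph V} {c : ℕ} (hc : 2 ≤ c) (hcn : c ≤ Fintype.card V)
    (hsmall : ∀ S : Finset V, #S < c - 1 → signedCount G S = 0)
    (hdvd : X ^ (Fintype.card V - c + 1) ∣ componentPoly G) :
    (componentPoly G).coeff (Fintype.card V - c + 1) =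
        (-1) ^ (Fintype.card V - c + 1) * signedCount G univ ∧
      ∑ S : Finset V with #S = c - 1, signedCount G S =
        (-1) ^ (Fintype.card V - c + 1) * signedCount G univ := by
  set t := Fintype.card V - c with ht
  set W : ℚ[X] := ∑ S : Finset V, C (signedCount G S) * (1 - X) ^ (#S - (c - 1)) with hW
  have hfac : componentPoly G = (1 - X) ^ (c - 2) * W := by
    rw [componentPoly_eq_sum_signedCount, hW, Finset.mul_sum]
    refine Finset.sum_congr rfl fun S _ => ?_
    by_cases hS : #S < c - 1
    · rw [hsmall S hS]
      simp
    · rw [mul_left_comm, ← pow_add]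
      congr 2
      omega
  have hcop : IsCoprime (X ^ (t + 1) : ℚ[X]) ((1 - X) ^ (c - 2)) := by
    refine IsCoprime.pow ⟨1, 1, ?_⟩
    ring
  rw [hfac] at hdvd
  obtain ⟨W', hW'⟩ := hcop.dvd_of_dvd_mul_left hdvd
  have hdeg : W.natDegree ≤ t + 1 := by
    refine natDegree_sum_le_of_forall_le _ _ fun S _ => ?_
    refine (natDegree_C_mul_le _ _).trans ?_
    refine (natDegree_pow_le).trans ?_
    have h1 : (1 - X : ℚ[X]).natDegree ≤ 1 := by
      refine (natDegree_sub_le _ _).trans ?_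
      simp
    have h2 : #S ≤ Fintype.card V := card_le_univ S
    calc (#S - (c - 1)) * (1 - X : ℚ[X]).natDegree ≤ (#S - (c - 1)) * 1 :=
          Nat.mul_le_mul_left _ h1
      _ ≤ t + 1 := by omega
  have hconst : W = C (W.coeff (t + 1)) * X ^ (t + 1) := by
    have h0 : W'.natDegree = 0 := by
      by_cases h0 : W' = 0
      · rw [h0, natDegree_zero]
      · have := hdeg
        rw [hW', natDegree_mul (pow_ne_zero _ X_ne_zero) h0, natDegree_X_pow] at this
        omega
    obtain ⟨a, ha⟩ : ∃ a, W' = C a := ⟨_, eq_C_of_natDegree_eq_zero h0⟩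
    rw [hW', ha, mul_comm, coeff_C_mul, coeff_X_pow, if_pos rfl, mul_one]
  -- Only the full vertex set reaches degree `t + 1`.
  have htop : W.coeff (t + 1) = (-1) ^ (t + 1) * signedCount G univ := by
    rw [hW, finsetSum_coeff, Finset.sum_eq_single univ]
    · rw [coeff_C_mul, coeff_one_sub_X_pow, card_univ,
        show Fintype.card V - (c - 1) = t + 1 by omega, Nat.choose_self]
      ring
    · intro S _ hS
      have hlt : #S < Fintype.card V := by
        rw [← card_univ]
        exact card_lt_card ⟨subset_univ S, fun h => hS (univ_subset_iff.1 h)⟩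
      rw [coeff_C_mul, coeff_one_sub_X_pow, Nat.choose_eq_zero_of_lt (by omega)]
      simp
    · simp
  constructor
  · rw [hfac, hconst, ← mul_assoc, coeff_mul_X_pow', if_pos le_rfl, Nat.sub_self, mul_comm,
      coeff_C_mul, coeff_one_sub_X_pow, htop]
    simp
  · rw [← htop]
    have h1 : W.eval 1 = W.coeff (t + 1) := by
      conv_lhs => rw [hconst]
      simp
    -- At 1 every term with `#S > c - 1` vanishes.
    rw [← h1, hW, eval_finsetSum, Finset.sum_filter]
    refine Finset.sum_congr rfl fun S _ => ?_
    split_ifs with hS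
    · simp [hS]
    · by_cases hS2 : #S < c - 1
      · rw [hsmall S hS2]
        simp
      · have : #S - (c - 1) ≠ 0 := by omega
        simp [this]

end SignedCounts

/-! ### Components smaller than the cycle -/

section SmallComponents
open scoped Classical
open Finset

variable {V : Type*} [Fintype V]

theorem mem_comps_of_agree {H H' : SimpleGraph V} {S : Finset V} (hS : S ∈ comps H)
    (h : ∀ a ∈ S, ∀ b, H.Adj a b ↔ H'.Adj a b) : S ∈ comps H' := by
  obtain ⟨v, rfl⟩ := mem_comps_iff.1 hS
  rw [mem_comps_iff]
  refine ⟨v, compOf_eq (self_mem_compOf H v) ?_ ?_⟩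
  · intro a ha b hab
    exact mem_compOf.2 ((mem_compOf.1 ha).trans ((h a ha b).2 hab).reachable)
  · intro w hw
    rw [mem_compOf, SimpleGraph.reachable_iff_reflTransGen] at hw
    induction hw with
    | refl => exact SimpleGraph.Reachable.refl v
    | tail hvb hbc ih =>
      refine ih.trans ((h _ ?_ _).1 hbc).reachable
      rw [mem_compOf, SimpleGraph.reachable_iff_reflTransGen]
      exact hvb

/-- Toggling the edge `xy` reverses the sign and does not affect whether `S` is a component. -/
theorem signedCount_eq_zero_of_adj {G : SimpleGraph V} {S : Finset V} {x y : V}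
    (hxy : G.Adj x y) (hx : x ∉ S) (hy : y ∉ S) : signedCount G S = 0 := by
  have hmem : ∀ A A' : Finset (Sym2 V), (∀ e, e ≠ s(x, y) → (e ∈ A ↔ e ∈ A')) →
      S ∈ comps (SimpleGraph.fromEdgeSet (A : Set (Sym2 V))) →
      S ∈ comps (SimpleGraph.fromEdgeSet (A' : Set (Sym2 V))) := by
    intro A A' hAA hS
    refine mem_comps_of_agree hS fun a ha b => ?_
    rw [SimpleGraph.fromEdgeSet_adj, SimpleGraph.fromEdgeSet_adj, mem_coe, mem_coe, hAA]
    rw [Ne, Sym2.eq_iff]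
    rintro (⟨rfl, rfl⟩ | ⟨rfl, rfl⟩)
    · exact hx ha
    · exact hy ha
  have he : s(x, y) ∈ G.edgeFinset := SimpleGraph.mem_edgeFinset.2 hxy
  refine Finset.sum_involution (fun A _ => if s(x, y) ∈ A then A.erase s(x, y) else insert s(x, y) A)
    ?_ ?_ ?_ ?_
  · intro A _
    split_ifs with h
    · rw [← card_erase_add_one h, pow_succ]
      ring
    · rw [card_insert_of_notMem h, pow_succ]
      ring
  · intro A _ _
    split_ifs with h
    · exact (erase_ssubset h).ne
    · exact (ssubset_insert h).ne'
  · intro A hA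
    rw [mem_filter, mem_powerset] at hA ⊢
    split_ifs with h
    · exact ⟨(erase_subset _ _).trans hA.1, hmem A _ (fun e he => by simp [he]) hA.2⟩
    · exact ⟨insert_subset he hA.1, hmem A _ (fun e he => by simp [he]) hA.2⟩
  · intro A _
    by_cases h : s(x, y) ∈ A
    · simp [h]
    · simp [h]

theorem card_comps_of_isIndependent_compl {H : SimpleGraph V} {S : Finset V} (hS : S ∈ comps H)
    (hind : ∀ x ∉ S, ∀ y ∉ S, ¬ H.Adj x y) : #(comps H) = Fintype.card V - #S + 1 := by
  have hiso : ∀ x ∉ S, compOf H x = {x} := by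
    intro x hx
    refine compOf_eq (mem_singleton_self x) ?_ fun w hw => by rw [mem_singleton.1 hw]
    intro a ha b hab
    rw [mem_singleton.1 ha] at hab
    refine absurd hab (hind x hx b fun hb => hx ?_)
    rw [eq_compOf_of_mem hS hb]
    exact mem_compOf.2 hab.symm.reachable
  have heq : comps H = insert S ((univ \ S).image fun x => {x}) := by
    ext T
    rw [mem_insert, mem_image]
    constructor
    · intro hT
      obtain ⟨x, rfl⟩ := mem_comps_iff.1 hT
      by_cases hx : x ∈ S
      · exact Or.inl (eq_compOf_of_mem hS hx).symm
      · exact Or.inr ⟨x, by simpa using hx, (hiso x hx).symm⟩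
    · rintro (rfl | ⟨x, hx, rfl⟩)
      · exact hS
      · rw [← hiso x (mem_sdiff.1 hx).2]
        exact compOf_mem_comps H x
  rw [heq, card_insert_of_notMem, card_image_of_injective, card_sdiff_of_subset (subset_univ S),
    card_univ]
  · intro x y hxy
    simpa using hxy
  · intro h1
    obtain ⟨x, hx, rfl⟩ := mem_image.1 h1
    exact (mem_sdiff.1 hx).2 (mem_singleton_self x)

/-- The edges of `G` with both ends in `S`. -/
noncomputable def edgesWithin (G : SimpleGraph V) (S : Finset V) : Finset (Sym2 V) :=
  G.edgeFinset.filter fun e => ∀ v ∈ e, v ∈ S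

/-- An edge not inside `S` has exactly one end outside `S`. -/
theorem sum_degree_compl {G : SimpleGraph V} {S : Finset V}
    (hind : ∀ x ∉ S, ∀ y ∉ S, ¬ G.Adj x y) :
    ∑ y ∈ univ \ S, G.degree y = #(G.edgeFinset \ edgesWithin G S) := by
  have h1 : G.edgeFinset \ edgesWithin G S = (univ \ S).biUnion fun y => G.incidenceFinset y := by
    ext e
    simp only [mem_sdiff, edgesWithin, mem_filter, mem_biUnion, SimpleGraph.mem_incidenceFinset,
      mem_univ, true_and, SimpleGraph.incidenceSet, Set.mem_ofPred_eq, SimpleGraph.mem_edgeFinset]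
    constructor
    · rintro ⟨he, h2⟩
      push Not at h2
      obtain ⟨v, hv, hvS⟩ := h2 he
      exact ⟨v, hvS, he, hv⟩
    · rintro ⟨v, hvS, he, hv⟩
      exact ⟨he, fun h2 => hvS (h2.2 v hv)⟩
  rw [h1, card_biUnion]
  · refine Finset.sum_congr rfl fun y _ => ?_
    rw [SimpleGraph.card_incidenceFinset_eq_degree]
  · intro x hx y hy hxy
    rw [mem_coe, mem_sdiff] at hx hy
    rw [Function.onFun, Finset.disjoint_left]
    intro e hex hey
    rw [SimpleGraph.mem_incidenceFinset] at hex hey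
    have h2 : e = s(x, y) := (Sym2.mem_and_mem_iff hxy).1 ⟨hex.2, hey.2⟩
    rw [h2] at hex
    exact hind x hx.2 y hy.2 hex.1

namespace IsUnicyclicWith

variable {G : SimpleGraph V} {c : ℕ} {φ : Fin c → V}

theorem one_le_degree (h : IsUnicyclicWith G c φ) (x : V) : 1 ≤ G.degree x := by
  have h1 := h.le_card
  have h3 := h.three_le
  have : Nontrivial V := Fintype.one_lt_card_iff_nontrivial.1 (by omega)
  exact h.connected.preconnected.degree_pos_of_nontrivial x

theorem two_le_degree (h : IsUnicyclicWith G c φ) (i : Fin c) : 2 ≤ G.degree (φ i) := by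
  obtain ⟨m, rfl⟩ : ∃ m, c = m + 3 := ⟨c - 3, by have := h.three_le; omega⟩
  rw [← SimpleGraph.cycleGraph_degree_three_le (v := i), ← SimpleGraph.card_neighborFinset_eq_degree,
    ← SimpleGraph.card_neighborFinset_eq_degree]
  rw [← card_image_of_injective _ h.injective]
  refine card_le_card fun x hx => ?_
  obtain ⟨j, hj, rfl⟩ := mem_image.1 hx
  rw [SimpleGraph.mem_neighborFinset] at hj ⊢
  exact h.adj i j hj

theorem image_subset_of_cycleEdges_subset {V : Type*} {G : SimpleGraph V} {c : ℕ} {φ : Fin c → V}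
    (h : IsUnicyclicWith G c φ) {A : Finset (Sym2 V)}
    {S : Finset V} (hs : cycleEdges φ ⊆ A) (hA : ∀ x y, s(x, y) ∈ A → x ∈ S) :
    univ.image φ ⊆ S := by
  intro x hx
  obtain ⟨i, -, rfl⟩ := mem_image.1 hx
  obtain ⟨m, rfl⟩ : ∃ m, c = m + 3 := ⟨c - 3, by have := h.three_le; omega⟩
  have h2 : (SimpleGraph.cycleGraph (m + 3)).Adj i (i + 1) := by
    rw [SimpleGraph.cycleGraph_adj]
    exact Or.inr (add_sub_cancel_left i 1)
  exact hA _ _ (hs (mem_cycleEdges h2))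

/-- No edge of `A` leaves the component `S` or avoids it. As `S` is too small to contain the cycle,
`A` is a spanning tree of `S`. -/
theorem card_eq_of_mem_comps (h : IsUnicyclicWith G c φ) {S : Finset V} (hcard : #S ≤ c - 1)
    (hind : ∀ x ∉ S, ∀ y ∉ S, ¬ G.Adj x y) {A : Finset (Sym2 V)} (hA : A ⊆ G.edgeFinset)
    (hS : S ∈ comps (SimpleGraph.fromEdgeSet (A : Set (Sym2 V)))) :
    A ⊆ edgesWithin G S ∧ #A + 1 = #S := by
  have h3 := h.three_le
  have hadj : ∀ x y, s(x, y) ∈ A → G.Adj x y := fun x y hxy =>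
    SimpleGraph.mem_edgeFinset.1 (hA hxy)
  have hadj' : ∀ x y, s(x, y) ∈ A → (SimpleGraph.fromEdgeSet (A : Set (Sym2 V))).Adj x y :=
    fun x y hxy => (SimpleGraph.fromEdgeSet_adj _).2 ⟨hxy, (hadj x y hxy).ne⟩
  have hin : ∀ x y, s(x, y) ∈ A → x ∈ S := by
    intro x y hxy
    by_contra hx
    by_cases hy : y ∈ S
    · apply hx
      rw [eq_compOf_of_mem hS hy]
      exact mem_compOf.2 (hadj' x y hxy).symm.reachable
    · exact hind x hx y hy (hadj x y hxy)
  constructor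
  · intro e he
    rw [edgesWithin, mem_filter]
    refine ⟨hA he, ?_⟩
    induction e with
    | h x y =>
      intro v hv
      rcases Sym2.mem_iff.1 hv with rfl | rfl
      · exact hin _ _ he
      · exact hin _ _ (by rwa [Sym2.eq_swap] at he)
  · have hn : ¬ cycleEdges φ ⊆ A := by
      intro hs
      have h4 := card_le_card (h.image_subset_of_cycleEdges_subset hs hin)
      rw [card_image_of_injective _ h.injective, card_univ, Fintype.card_fin] at h4
      omega
    have h5 := h.card_comps_of_not_subset hA hn
    have h6 := card_comps_of_isIndependent_compl hS (by
      intro x hx y _ hxy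
      exact hx (hin x y ((SimpleGraph.fromEdgeSet_adj _).1 hxy).1))
    have h7 := card_le_univ S
    have h8 := card_pos_of_mem_comps hS
    omega

/-- The full set of edges within `S` also has `S` as a component, so the same count applies to it:
it contains `A` and has the same size. -/
theorem edgesWithin_of_mem_comps (h : IsUnicyclicWith G c φ) {S : Finset V} (hcard : #S ≤ c - 1)
    (hind : ∀ x ∉ S, ∀ y ∉ S, ¬ G.Adj x y) {A : Finset (Sym2 V)} (hA : A ⊆ G.edgeFinset)
    (hS : S ∈ comps (SimpleGraph.fromEdgeSet (A : Set (Sym2 V)))) :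
    A = edgesWithin G S := by
  have h1 := h.card_eq_of_mem_comps hcard hind hA hS
  have hE : edgesWithin G S ⊆ G.edgeFinset := filter_subset _ _
  have hS' : S ∈ comps (SimpleGraph.fromEdgeSet (edgesWithin G S : Set (Sym2 V))) := by
    obtain ⟨v, hv⟩ := mem_comps_iff.1 hS
    rw [mem_comps_iff]
    refine ⟨v, compOf_eq (hv ▸ self_mem_compOf _ v) ?_ ?_⟩
    · intro a _ b hab
      have h2 := ((SimpleGraph.fromEdgeSet_adj _).1 hab).1
      rw [mem_coe, edgesWithin, mem_filter] at h2
      exact h2.2 b (Sym2.mem_mk_right a b)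
    · intro w hw
      rw [← hv] at hw
      exact (mem_compOf.1 hw).mono (SimpleGraph.fromEdgeSet_mono (by exact_mod_cast h1.1))
  have h2 := h.card_eq_of_mem_comps hcard hind hE hS'
  exact eq_of_subset_of_card_le h1.1 (by omega)

theorem abs_signedCount_le (h : IsUnicyclicWith G c φ) {S : Finset V} (hcard : #S ≤ c - 1) :
    |signedCount G S| ≤ 1 := by
  by_cases hind : ∀ x ∉ S, ∀ y ∉ S, ¬ G.Adj x y
  · have h1 : G.edgeFinset.powerset.filter (fun A : Finset (Sym2 V) =>
        S ∈ comps (SimpleGraph.fromEdgeSet (A : Set (Sym2 V)))) ⊆ {edgesWithin G S} := by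
      intro A hA
      rw [mem_filter, mem_powerset] at hA
      exact mem_singleton.2 (h.edgesWithin_of_mem_comps hcard hind hA.1 hA.2)
    rw [signedCount]
    rcases subset_singleton_iff.1 h1 with h2 | h2
    · rw [h2]
      simp
    · rw [h2]
      simp
  · push Not at hind
    obtain ⟨x, hx, y, hy, hxy⟩ := hind
    rw [signedCount_eq_zero_of_adj hxy hx hy]
    simp

/-- The `n - #S + 1` edges not inside `S` each have one end among the `n - #S` outer vertices, whose
degrees therefore exceed 1 by a total of 1. Some cycle vertex lies outside `S` and uses up this
excess; all other outer vertices are leaves. -/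
theorem of_signedCount_ne_zero (h : IsUnicyclicWith G c φ) {S : Finset V} (hcard : #S ≤ c - 1)
    (hne : signedCount G S ≠ 0) :
    ∃ i, S = (univ.erase i).image φ ∧ G.degree (φ i) = 2 ∧
      ∀ y, y ∉ Set.range φ → G.degree y = 1 := by
  have h3 := h.three_le
  have hind : ∀ x ∉ S, ∀ y ∉ S, ¬ G.Adj x y := fun x hx y hy hxy =>
    hne (signedCount_eq_zero_of_adj hxy hx hy)
  obtain ⟨A, hA, -⟩ := Finset.exists_ne_zero_of_sum_ne_zero hne
  rw [mem_filter, mem_powerset] at hA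
  have hAE := h.edgesWithin_of_mem_comps hcard hind hA.1 hA.2
  have hcardA := (h.card_eq_of_mem_comps hcard hind hA.1 hA.2).2
  have hsum := sum_degree_compl hind
  rw [card_sdiff_of_subset (show edgesWithin G S ⊆ G.edgeFinset from filter_subset _ _), h.card_edgeFinset, ← hAE] at hsum
  have hn : #S ≤ Fintype.card V := card_le_univ S
  have hcompl : #(univ \ S) = Fintype.card V - #S := by
    rw [card_sdiff_of_subset (subset_univ S), card_univ]
  have hsum1 : ∑ y ∈ univ \ S, (G.degree y - 1) = 1 := by
    have h4 : ∑ y ∈ univ \ S, (G.degree y - 1) + ∑ y ∈ univ \ S, 1 =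
        ∑ y ∈ univ \ S, G.degree y := by
      rw [← Finset.sum_add_distrib]
      refine Finset.sum_congr rfl fun y _ => ?_
      have := h.one_le_degree y
      omega
    rw [hsum, Finset.sum_const, smul_eq_mul, mul_one, hcompl] at h4
    omega
  obtain ⟨i, hi⟩ : ∃ i, φ i ∉ S := by
    by_contra! hall
    have h4 : univ.image φ ⊆ S := by
      intro x hx
      obtain ⟨i, -, rfl⟩ := mem_image.1 hx
      exact hall i
    have h5 := card_le_card h4
    rw [card_image_of_injective _ h.injective, card_univ, Fintype.card_fin] at h5
    omega
  have hi' : φ i ∈ univ \ S := mem_sdiff.2 ⟨mem_univ _, hi⟩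
  rw [← Finset.add_sum_erase _ _ hi'] at hsum1
  have hdi := h.two_le_degree i
  have hzero : ∑ y ∈ (univ \ S).erase (φ i), (G.degree y - 1) = 0 := by omega
  have hothers : ∀ y, y ∉ S → y ≠ φ i → G.degree y = 1 := by
    intro y hy hyi
    have h4 := (Finset.sum_eq_zero_iff.1 hzero) y
      (mem_erase.2 ⟨hyi, mem_sdiff.2 ⟨mem_univ _, hy⟩⟩)
    have := h.one_le_degree y
    omega
  -- A second cycle vertex outside `S` would be a leaf, but cycle vertices have degree at least 2.
  have hsub : (univ.erase i).image φ ⊆ S := by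
    intro x hx
    obtain ⟨j, hj, rfl⟩ := mem_image.1 hx
    by_contra hjS
    have h4 := hothers (φ j) hjS fun h5 => (mem_erase.1 hj).1 (h.injective h5)
    have := h.two_le_degree j
    omega
  have hcim : #((univ.erase i).image φ) = c - 1 := by
    rw [card_image_of_injective _ h.injective, card_erase_of_mem (mem_univ _), card_univ,
      Fintype.card_fin]
  have hSeq : (univ.erase i).image φ = S := eq_of_subset_of_card_le hsub (by omega)
  refine ⟨i, hSeq.symm, by omega, fun y hy => hothers y ?_ ?_⟩
  · intro hyS
    rw [← hSeq] at hyS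
    obtain ⟨j, -, rfl⟩ := mem_image.1 hyS
    exact hy ⟨j, rfl⟩
  · rintro rfl
    exact hy ⟨i, rfl⟩

theorem signedCount_eq_zero_of_card_lt (h : IsUnicyclicWith G c φ) {S : Finset V}
    (hcard : #S < c - 1) : signedCount G S = 0 := by
  by_contra hne
  obtain ⟨i, hS, -⟩ := h.of_signedCount_ne_zero hcard.le hne
  rw [hS, card_image_of_injective _ h.injective, card_erase_of_mem (mem_univ _), card_univ,
    Fintype.card_fin] at hcard
  omega

/-- Terms have absolute value at most 1, and distinct sets with nonzero count omit distinct cycle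
vertices of degree 2. So at least `c - 1` cycle vertices have degree 2. -/
theorem degrees_of_abs_sum_signedCount (h : IsUnicyclicWith G c φ)
    (hsum : (c : ℚ) - 1 ≤ |∑ S : Finset V with #S = c - 1, signedCount G S|) :
    (∃ i₀, ∀ i, i ≠ i₀ → G.degree (φ i) = 2) ∧ ∀ y, y ∉ Set.range φ → G.degree y = 1 := by
  have h3 := h.three_le
  set D := univ.filter fun i => G.degree (φ i) = 2 with hD
  set Q := (univ : Finset (Finset V)).filter fun S => #S = c - 1 ∧ signedCount G S ≠ 0 with hQ
  have hQsub : Q ⊆ D.image fun i => (univ.erase i).image φ := by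
    intro S hS
    rw [hQ, mem_filter] at hS
    obtain ⟨i, hSi, hdi, -⟩ := h.of_signedCount_ne_zero hS.2.1.le hS.2.2
    exact mem_image.2 ⟨i, mem_filter.2 ⟨mem_univ _, hdi⟩, hSi.symm⟩
  have hQD : #Q ≤ #D := (card_le_card hQsub).trans card_image_le
  have hQc : c - 1 ≤ #Q := by
    have h4 : |∑ S : Finset V with #S = c - 1, signedCount G S| ≤ #Q := by
      rw [← Finset.sum_filter_ne_zero, Finset.filter_filter]
      refine (Finset.abs_sum_le_sum_abs _ _).trans ?_
      rw [Finset.card_eq_sum_ones, Nat.cast_sum]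
      refine Finset.sum_le_sum fun S hS => ?_
      rw [mem_filter] at hS
      rw [Nat.cast_one]
      exact h.abs_signedCount_le hS.2.1.le
    have h5 := hsum.trans h4
    have h6 : ((c - 1 : ℕ) : ℚ) ≤ #Q := by
      rwa [Nat.cast_sub (by omega), Nat.cast_one]
    exact_mod_cast h6
  constructor
  · have h4 : #(univ \ D) ≤ 1 := by
      rw [card_sdiff_of_subset (subset_univ D), card_univ, Fintype.card_fin]
      omega
    rcases (univ \ D).eq_empty_or_nonempty with h5 | ⟨i₀, hi₀⟩
    · refine ⟨⟨0, by omega⟩, fun i _ => ?_⟩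
      have h6 : i ∈ D := sdiff_eq_empty_iff_subset.1 h5 (mem_univ i)
      exact (mem_filter.1 h6).2
    · refine ⟨i₀, fun i hi => ?_⟩
      by_contra hdi
      refine hi (card_le_one.1 h4 i ?_ i₀ hi₀)
      exact mem_sdiff.2 ⟨mem_univ i, fun h6 => hdi (mem_filter.1 h6).2⟩
  · obtain ⟨S, hS⟩ : Q.Nonempty := card_pos.1 (by omega)
    rw [hQ, mem_filter] at hS
    exact (h.of_signedCount_ne_zero hS.2.1.le hS.2.2).choose_spec.2.2

end IsUnicyclicWith

end SmallComponents

/-! ### Recognizing the cuttlefish -/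

section Cuttlefish
open scoped Classical
open Finset

theorem mem_of_reachable_of_closed {V : Type*} {H : SimpleGraph V} {T : Set V} {v w : V}
    (hv : v ∈ T) (hT : ∀ a ∈ T, ∀ b, H.Adj a b → b ∈ T) (h : H.Reachable v w) : w ∈ T := by
  obtain ⟨p⟩ := h
  induction p with
  | nil => exact hv
  | cons hadj _ ih => exact ih (hT _ hv _ hadj)

theorem chromaticSymmetricFunction_congr {V W : Type*} [Fintype V] [Fintype W]
    {G : SimpleGraph V} {G' : SimpleGraph W} (e : G ≃g G') :
    chromaticSymmetricFunction G = chromaticSymmetricFunction G' := by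
  funext m
  have hmon : ∀ κ : V → ℕ, colorMonomial (fun w => κ (e.symm w)) = colorMonomial κ := fun κ =>
    Fintype.sum_equiv e.symm.toEquiv _ _ fun _ => rfl
  have hmon' : ∀ κ : W → ℕ, colorMonomial (fun v => κ (e v)) = colorMonomial κ := fun κ =>
    Fintype.sum_equiv e.toEquiv _ _ fun _ => rfl
  refine congrArg (Nat.cast (R := ℚ)) (Nat.card_congr ⟨fun κ => ⟨κ.1.comp e.symm.toHom, ?_⟩,
    fun κ => ⟨κ.1.comp e.toHom, ?_⟩, ?_, ?_⟩)
  · exact (hmon κ.1).trans κ.2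
  · exact (hmon' κ.1).trans κ.2
  · intro κ
    ext v
    exact congrArg κ.1 (e.symm_apply_apply v)
  · intro κ
    ext v
    exact congrArg κ.1 (e.apply_symm_apply v)

/-- In the pendant formula every summand has a factor `iterDiff X #Λ m`, whose image `iterDiff X m
#Λ` involves in each monomial a variable of index at least `#Λ`. -/
theorem exists_mem_ge_of_coeff_starPoly_ne_zero {V : Type*} [Fintype V] {G : SimpleGraph V} {v : V}
    {Λ : Finset V} (h : IsPendantSet G v Λ) {d : ℕ →₀ ℕ} (hd : (starPoly G).coeff d ≠ 0) :
    ∃ k, #Λ ≤ k ∧ d k ≠ 0 := by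
  have hD : ∀ m t : ℕ, iterDiff (MvPolynomial.X : ℕ → MvPolynomial ℕ ℚ) m t ∈
      Ideal.span (MvPolynomial.X '' {k | t ≤ k}) := by
    intro m
    induction m with
    | zero => exact fun t => Ideal.subset_span (Set.mem_image_of_mem _ (Set.mem_ofPred.2 le_rfl))
    | succ m ih =>
      intro t
      refine Ideal.sub_mem _ (Ideal.mul_mem_left _ _ (ih t)) ?_
      refine Ideal.span_mono (Set.image_mono ?_) (ih (t + 1))
      exact fun k hk => (Nat.le_succ t).trans hk
  have hS : starPoly G ∈ Ideal.span (MvPolynomial.X '' {k | #Λ ≤ k}) := by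
    rw [starPoly, powerSumPoly_pendant h, map_sum]
    refine Ideal.sum_mem _ fun A _ => ?_
    rw [map_mul, map_mul, starHom_iterDiff]
    exact Ideal.mul_mem_left _ _ (Ideal.mul_mem_left _ _ (hD _ _))
  exact MvPolynomial.mem_ideal_span_X_image.1 hS d (MvPolynomial.mem_support_iff.2 hd)

theorem isPendantSet_cuttlefish (m t : ℕ) :
    IsPendantSet (cuttlefish (m + 3) t) (Sum.inl 0) (univ.image Sum.inr) := by
  refine ⟨by simp, fun x hx y => ?_⟩
  obtain ⟨j, -, rfl⟩ := mem_image.1 hx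
  rcases y with i | i
  · simp only [cuttlefish, Sum.inl.injEq]
    exact Fin.val_eq_zero_iff
  · simp [cuttlefish]

theorem two_neighbors {m : ℕ} (i : Fin (m + 3)) :
    ∃ a b, a ≠ b ∧ (SimpleGraph.cycleGraph (m + 3)).Adj i a ∧
      (SimpleGraph.cycleGraph (m + 3)).Adj i b := by
  have h1 : #((SimpleGraph.cycleGraph (m + 3)).neighborFinset i) = 2 := by
    rw [SimpleGraph.card_neighborFinset_eq_degree, SimpleGraph.cycleGraph_degree_three_le]
  obtain ⟨a, b, hab, h2⟩ := card_eq_two.1 h1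
  refine ⟨a, b, hab, ?_, ?_⟩
  · rw [← SimpleGraph.mem_neighborFinset, h2]
    simp
  · rw [← SimpleGraph.mem_neighborFinset, h2]
    simp

/-- Both cycles are 2-regular, so an injective homomorphism maps neighbourhoods onto neighbourhoods.
-/
theorem neighborFinset_image_of_copy {k m : ℕ} {g : Fin (k + 3) → Fin (m + 3)}
    (hg : Function.Injective g)
    (hadj : ∀ a b, (SimpleGraph.cycleGraph (k + 3)).Adj a b →
      (SimpleGraph.cycleGraph (m + 3)).Adj (g a) (g b)) {a : Fin (k + 3)} {j : Fin (m + 3)}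
    (hj : (SimpleGraph.cycleGraph (m + 3)).Adj (g a) j) :
    ∃ b, (SimpleGraph.cycleGraph (k + 3)).Adj a b ∧ g b = j := by
  have h1 : ((SimpleGraph.cycleGraph (k + 3)).neighborFinset a).image g =
      (SimpleGraph.cycleGraph (m + 3)).neighborFinset (g a) := by
    refine eq_of_subset_of_card_le ?_ ?_
    · intro x hx
      obtain ⟨b, hb, rfl⟩ := mem_image.1 hx
      rw [SimpleGraph.mem_neighborFinset] at hb ⊢
      exact hadj a b hb
    · rw [card_image_of_injective _ hg, SimpleGraph.card_neighborFinset_eq_degree,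
        SimpleGraph.card_neighborFinset_eq_degree, SimpleGraph.cycleGraph_degree_three_le,
        SimpleGraph.cycleGraph_degree_three_le]
  rw [← SimpleGraph.mem_neighborFinset, ← h1, mem_image] at hj
  obtain ⟨b, hb, rfl⟩ := hj
  exact ⟨b, (SimpleGraph.mem_neighborFinset _ _ _).1 hb, rfl⟩

/-- No cycle passes through a leaf, and a cycle inside the `c`-cycle is closed under neighbours,
hence is all of it. -/
theorem isUnicyclicWith_cuttlefish (m t : ℕ) :
    IsUnicyclicWith (cuttlefish (m + 3) t) (m + 3) Sum.inl := by
  have hcyc : ∀ i, (cuttlefish (m + 3) t).Reachable (Sum.inl 0) (Sum.inl i) := by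
    intro i
    have h1 := (SimpleGraph.cycleGraph_preconnected (n := m + 3)) 0 i
    exact h1.map (G' := cuttlefish (m + 3) t) ⟨Sum.inl, fun h => h⟩
  have hall : ∀ x, (cuttlefish (m + 3) t).Reachable (Sum.inl 0) x := by
    rintro (i | j)
    · exact hcyc i
    · exact SimpleGraph.Adj.reachable (show ((0 : Fin (m + 3)) : ℕ) = 0 from rfl)
  have : Nonempty (Fin (m + 3) ⊕ Fin t) := ⟨Sum.inl 0⟩
  refine ⟨⟨fun x y => (hall x).symm.trans (hall y)⟩, by omega, Sum.inl_injective,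
    fun i j h => h, ?_⟩
  intro k hk f i j hij
  obtain ⟨k, rfl⟩ : ∃ k', k = k' + 3 := ⟨k - 3, by omega⟩
  have hinl : ∀ a, ∃ i, f a = Sum.inl i := by
    intro a
    obtain ⟨b, b', hbb, hb, hb'⟩ := two_neighbors a
    rcases hfa : f a with i | l
    · exact ⟨i, rfl⟩
    · exfalso
      have hleaf := (isPendantSet_cuttlefish m t).2 (Sum.inr l) (by simp)
      have h1 : (cuttlefish (m + 3) t).Adj (f a) (f b) := f.toHom.map_adj hb
      have h2 : (cuttlefish (m + 3) t).Adj (f a) (f b') := f.toHom.map_adj hb'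
      rw [hfa, hleaf] at h1 h2
      exact hbb (f.injective (h1.trans h2.symm))
  choose g hg using hinl
  have gi : Function.Injective g := fun a b hab => f.injective (by
    change f a = f b
    rw [hg, hg, hab])
  have gadj : ∀ a b, (SimpleGraph.cycleGraph (k + 3)).Adj a b →
      (SimpleGraph.cycleGraph (m + 3)).Adj (g a) (g b) := by
    intro a b hab
    have h1 : (cuttlefish (m + 3) t).Adj (f a) (f b) := f.toHom.map_adj hab
    rw [hg, hg] at h1
    exact h1
  have hsurj : i ∈ Set.range g := by
    refine mem_of_reachable_of_closed (v := g 0) ⟨0, rfl⟩ ?_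
      (SimpleGraph.cycleGraph_preconnected (n := m + 3) (g 0) i)
    rintro _ ⟨a, rfl⟩ b hb
    obtain ⟨b', -, rfl⟩ := neighborFinset_image_of_copy gi gadj hb
    exact ⟨b', rfl⟩
  obtain ⟨a, rfl⟩ := hsurj
  obtain ⟨b, hab, rfl⟩ := neighborFinset_image_of_copy gi gadj hij
  exact ⟨a, b, hab, hg a, hg b⟩

namespace IsUnicyclicWith

variable {V : Type*} [Fintype V] {G : SimpleGraph V}

theorem degree_eq_two_of_card_eq {c : ℕ} {φ : Fin c → V} (h : IsUnicyclicWith G c φ)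
    (hn : Fintype.card V = c) (i : Fin c) : G.degree (φ i) = 2 := by
  have hb : Function.Bijective φ :=
    (Fintype.bijective_iff_injective_and_card φ).2 ⟨h.injective, by rw [Fintype.card_fin, hn]⟩
  have h1 := G.sum_degrees_eq_twice_card_edges
  rw [h.card_edgeFinset, hn, ← Function.Bijective.sum_comp hb (fun v : V => G.degree v)] at h1
  have h2 : ∑ _i : Fin c, 2 = ∑ i, G.degree (φ i) := by
    rw [h1, Finset.sum_const, card_univ, Fintype.card_fin, smul_eq_mul, mul_comm]
  exact ((Finset.sum_eq_sum_iff_of_le fun i _ => h.two_le_degree i).1 h2 i (mem_univ i)).symm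

theorem adj_iff_of_degree_eq_two {m : ℕ} {φ : Fin (m + 3) → V} (h : IsUnicyclicWith G (m + 3) φ)
    {i : Fin (m + 3)} (hi : G.degree (φ i) = 2) (x : V) :
    G.Adj (φ i) x ↔ ∃ j, (SimpleGraph.cycleGraph (m + 3)).Adj i j ∧ φ j = x := by
  have h1 : ((SimpleGraph.cycleGraph (m + 3)).neighborFinset i).image φ =
      G.neighborFinset (φ i) := by
    refine eq_of_subset_of_card_le ?_ ?_
    · intro x hx
      obtain ⟨b, hb, rfl⟩ := mem_image.1 hx
      rw [SimpleGraph.mem_neighborFinset] at hb ⊢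
      exact h.adj i b hb
    · rw [card_image_of_injective _ h.injective, SimpleGraph.card_neighborFinset_eq_degree,
        SimpleGraph.card_neighborFinset_eq_degree, SimpleGraph.cycleGraph_degree_three_le, hi]
  rw [← SimpleGraph.mem_neighborFinset, ← h1, mem_image]
  simp only [SimpleGraph.mem_neighborFinset]

/-- Cycle vertices other than `φ i₀` have only their two cycle neighbours, which rules out chords
and leaves attached to them. -/
theorem nonempty_iso_cuttlefish {m t : ℕ} {φ : Fin (m + 3) → V} (h : IsUnicyclicWith G (m + 3) φ)
    (hn : Fintype.card V = m + 3 + t) {i₀ : Fin (m + 3)}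
    (hcyc : ∀ i, i ≠ i₀ → G.degree (φ i) = 2) (hleaf : ∀ y, y ∉ Set.range φ → G.degree y = 1) :
    Nonempty (G ≃g cuttlefish (m + 3) t) := by
  have hφφ : ∀ i j, G.Adj (φ i) (φ j) ↔ (SimpleGraph.cycleGraph (m + 3)).Adj i j := by
    have h1 : ∀ i j, i ≠ i₀ → (G.Adj (φ i) (φ j) ↔
        (SimpleGraph.cycleGraph (m + 3)).Adj i j) := by
      intro i j hi
      rw [h.adj_iff_of_degree_eq_two (hcyc i hi)]
      constructor
      · rintro ⟨j', hj', hjj⟩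
        exact h.injective hjj ▸ hj'
      · exact fun hij => ⟨j, hij, rfl⟩
    intro i j
    by_cases hi : i = i₀
    · by_cases hj : j = i₀
      · subst hi hj
        simp
      · rw [G.adj_comm (φ i), (SimpleGraph.cycleGraph (m + 3)).adj_comm i, h1 j i hj]
    · exact h1 i j hi
  have hout : ∀ y, y ∉ Set.range φ → ∀ z, G.Adj y z ↔ z = φ i₀ := by
    intro y hy
    obtain ⟨u, hu⟩ := card_eq_one.1 ((G.card_neighborFinset_eq_degree y).trans (hleaf y hy))
    have hyu : ∀ z, G.Adj y z ↔ z = u := by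
      intro z
      rw [← SimpleGraph.mem_neighborFinset, hu, mem_singleton]
    suffices hu0 : u = φ i₀ by
      rw [← hu0]
      exact hyu
    have hadj : G.Adj y u := (hyu u).2 rfl
    by_cases hur : u ∈ Set.range φ
    · obtain ⟨i, rfl⟩ := hur
      by_contra hne
      have hi : i ≠ i₀ := fun hi => hne (by rw [hi])
      obtain ⟨j, -, hj⟩ := (h.adj_iff_of_degree_eq_two (hcyc i hi) y).1 hadj.symm
      exact hy ⟨j, hj⟩
    · exfalso
      obtain ⟨w, hw⟩ := card_eq_one.1 ((G.card_neighborFinset_eq_degree u).trans (hleaf u hur))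
      have huw : ∀ z, G.Adj u z ↔ z = w := by
        intro z
        rw [← SimpleGraph.mem_neighborFinset, hw, mem_singleton]
      have hyw : y = w := (huw y).1 hadj.symm
      -- Two adjacent leaves would form a whole component, against connectedness.
      have h2 : φ i₀ ∈ ({y, u} : Set V) := by
        refine mem_of_reachable_of_closed (v := y) (Set.mem_insert _ _) ?_
          (h.connected.preconnected y (φ i₀))
        rintro a (rfl | rfl) b hab
        · exact Or.inr ((hyu b).1 hab)
        · exact Or.inl (((huw b).1 hab).trans hyw.symm)
      rcases h2 with h2 | h2
      · exact hy ⟨i₀, h2⟩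
      · exact hur ⟨i₀, h2⟩
  have hcard : Fintype.card {y // y ∉ Set.range φ} = t := by
    rw [Fintype.card_subtype_compl, hn]
    have h2 : Fintype.card {y // y ∈ Set.range φ} = m + 3 := by
      have := Set.card_range_of_injective h.injective
      rw [Fintype.card_fin] at this
      convert this
    rw [h2, Nat.add_sub_cancel_left]
  let e : Fin t ≃ {y // y ∉ Set.range φ} := (Fintype.equivFinOfCardEq hcard).symm
  -- The rotation by `i₀` puts the exceptional vertex at position 0.
  let f : Fin (m + 3) ⊕ Fin t → V := Sum.elim (fun i => φ (i + i₀)) (fun j => (e j).1)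
  have hf : Function.Bijective f := by
    constructor
    · rintro (i | i) (j | j) hij
      · exact congrArg Sum.inl (add_right_cancel (h.injective hij))
      · exact absurd ⟨_, hij⟩ (e j).2
      · exact absurd ⟨_, hij.symm⟩ (e i).2
      · exact congrArg Sum.inr (e.injective (Subtype.ext hij))
    · intro x
      by_cases hx : x ∈ Set.range φ
      · obtain ⟨i, rfl⟩ := hx
        exact ⟨Sum.inl (i - i₀), congrArg φ (sub_add_cancel i i₀)⟩
      · exact ⟨Sum.inr (e.symm ⟨x, hx⟩), congrArg Subtype.val (e.apply_symm_apply ⟨x, hx⟩)⟩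
  have hval : ∀ i : Fin (m + 3), φ (i + i₀) = φ i₀ ↔ i.val = 0 := by
    intro i
    rw [h.injective.eq_iff, add_eq_right, Fin.val_eq_zero_iff]
  refine ⟨RelIso.symm ⟨Equiv.ofBijective f hf, ?_⟩⟩
  rintro (i | i) (j | j)
  · change G.Adj (φ (i + i₀)) (φ (j + i₀)) ↔ (SimpleGraph.cycleGraph (m + 3)).Adj i j
    rw [hφφ, SimpleGraph.cycleGraph_adj, SimpleGraph.cycleGraph_adj, add_sub_add_right_eq_sub,
      add_sub_add_right_eq_sub]
  · change G.Adj (φ (i + i₀)) (e j).1 ↔ i.val = 0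
    rw [G.adj_comm, hout _ (e j).2, hval]
  · change G.Adj (e i).1 (φ (j + i₀)) ↔ j.val = 0
    rw [hout _ (e i).2, hval]
  · change G.Adj (e i).1 (e j).1 ↔ False
    rw [hout _ (e i).2, iff_false]
    exact fun h2 => (e j).2 ⟨i₀, h2.symm⟩

end IsUnicyclicWith

end Cuttlefish

/-! ### Coefficients when every partition has a part exceeding `t` -/

section LeadingTerms
open scoped Classical
open Finset Polynomial

theorem exists_eq_single_add {d : ℕ →₀ ℕ} {k : ℕ} (hd : d k ≠ 0) :
    ∃ d', d = Finsupp.single k 1 + d' :=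
  ⟨d - Finsupp.single k 1, (add_tsub_cancel_of_le
    (Finsupp.single_le_iff.2 (Nat.one_le_iff_ne_zero.2 hd))).symm⟩

theorem eq_single_zero_of_weight_eq_zero {d : ℕ →₀ ℕ}
    (hd : Finsupp.weight (fun k : ℕ => k) d = 0) : d = Finsupp.single 0 (d 0) := by
  ext j
  by_cases hj : j = 0
  · rw [hj, Finsupp.single_eq_same]
  · rw [Finsupp.single_eq_of_ne hj]
    have := Finsupp.le_weight (fun k : ℕ => k) hj d
    omega

/-- The variable of index `k ≥ j` already uses up the index total `j`, so the rest is a power of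
`X_0`. -/
theorem eq_hook_of_weight {d : ℕ →₀ ℕ} {n j k : ℕ}
    (hn : Finsupp.weight (fun k : ℕ => k + 1) d = n) (hj : Finsupp.weight (fun k : ℕ => k) d = j)
    (hjk : j ≤ k) (hdk : d k ≠ 0) : d = Finsupp.single j 1 + Finsupp.single 0 (n - 1 - j) := by
  have h1 : k ≤ j := hj ▸ Finsupp.le_weight_of_ne_zero (w := fun k : ℕ => k)
    (fun _ => Nat.zero_le _) hdk
  obtain rfl : k = j := le_antisymm h1 hjk
  obtain ⟨d', rfl⟩ := exists_eq_single_add hdk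
  rw [map_add, Finsupp.weight_single, one_smul] at hn hj
  have h2 := eq_single_zero_of_weight_eq_zero (d := d') (by omega)
  rw [h2, Finsupp.weight_single, smul_eq_mul] at hn
  rw [show n - 1 - k = d' 0 by omega, ← h2]

/-- Beyond a variable of index at least `t`, the index total `t + 1` leaves at most one unit to
distribute. -/
theorem eq_hook_or_of_weight {d : ℕ →₀ ℕ} {n t k : ℕ}
    (hn : Finsupp.weight (fun k : ℕ => k + 1) d = n)
    (hj : Finsupp.weight (fun k : ℕ => k) d = t + 1) (htk : t ≤ k) (hdk : d k ≠ 0) :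
    d = Finsupp.single (t + 1) 1 + Finsupp.single 0 (n - 1 - (t + 1)) ∨
      d = Finsupp.single t 1 + (Finsupp.single 1 1 + Finsupp.single 0 (n - 3 - t)) := by
  rcases htk.eq_or_lt with rfl | h
  · right
    obtain ⟨d', rfl⟩ := exists_eq_single_add hdk
    rw [map_add, Finsupp.weight_single, one_smul] at hn hj
    have hd' : Finsupp.weight (fun k : ℕ => k) d' = 1 := by omega
    obtain ⟨i, hi, hi'⟩ : ∃ i, 1 ≤ i ∧ d' i ≠ 0 := by
      by_contra! hcon
      rw [Finsupp.weight_apply, Finsupp.sum, Finset.sum_eq_zero] at hd'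
      · omega
      · intro i _
        rcases Nat.eq_zero_or_pos i with rfl | hi
        · simp
        · rw [hcon i hi, zero_smul]
    have h1 := eq_hook_of_weight (n := n - (t + 1)) (by omega) hd' hi hi'
    rw [show n - 3 - t = n - (t + 1) - 1 - 1 by omega, ← h1]
  · exact Or.inl (eq_hook_of_weight hn hj h hdk)

variable {V : Type*} [Fintype V] {G : SimpleGraph V}

theorem coeff_rankPoly_eq_sum {j : ℕ} (s : Finset (ℕ →₀ ℕ))
    (hs : ∀ d ∈ s, Finsupp.weight (fun k : ℕ => k) d = j)
    (h : ∀ d, (starPoly G).coeff d ≠ 0 → Finsupp.weight (fun k : ℕ => k) d = j → d ∈ s) :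
    (rankPoly G).coeff j = ∑ d ∈ s, (starPoly G).coeff d := by
  rw [coeff_rankPoly]
  refine Finset.sum_subset (fun d hd => ?_) fun d hd hd' => ?_
  · rw [mem_filter, MvPolynomial.mem_support_iff] at hd
    exact h d hd.1 hd.2
  · by_contra hne
    exact hd' (mem_filter.2 ⟨MvPolynomial.mem_support_iff.2 hne, hs d hd⟩)

theorem coeff_rankPoly_eq_coeff_componentPoly {t : ℕ} (ht : t ≠ 0) (htn : t < Fintype.card V)
    (hvan : ∀ d, (starPoly G).coeff d ≠ 0 → ∃ k, t ≤ k ∧ d k ≠ 0) :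
    (rankPoly G).coeff t = (componentPoly G).coeff t := by
  rw [coeff_rankPoly_eq_sum {Finsupp.single t 1 + Finsupp.single 0 (Fintype.card V - 1 - t)},
    sum_singleton, coeff_hook_starPoly G ht htn]
  · simp [Finsupp.weight_single, -Finsupp.single_tsub]
  · intro d hd hdt
    obtain ⟨k, hk, hdk⟩ := hvan d hd
    exact mem_singleton.2 (eq_hook_of_weight (isWeightedHomogeneous_starPoly G hd) hdt hk hdk)

theorem coeff_rankPoly_succ_eq {t : ℕ} (ht : t ≠ 0) (htn : t + 1 < Fintype.card V)
    (hvan : ∀ d, (starPoly G).coeff d ≠ 0 → ∃ k, t ≤ k ∧ d k ≠ 0) :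
    (rankPoly G).coeff (t + 1) = (componentPoly G).coeff (t + 1) + (starPoly G).coeff
      (Finsupp.single t 1 + (Finsupp.single 1 1 + Finsupp.single 0 (Fintype.card V - 3 - t))) := by
  rw [coeff_rankPoly_eq_sum
    {Finsupp.single (t + 1) 1 + Finsupp.single 0 (Fintype.card V - 1 - (t + 1)),
      Finsupp.single t 1 + (Finsupp.single 1 1 + Finsupp.single 0 (Fintype.card V - 3 - t))},
    sum_pair, coeff_hook_starPoly G (Nat.succ_ne_zero t) htn]
  · intro h
    have := DFunLike.congr_fun h (t + 1)
    simp [ht] at this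
  · simp [Finsupp.weight_single, -Finsupp.single_tsub]
  · intro d hd hdt
    obtain ⟨k, hk, hdk⟩ := hvan d hd
    rw [mem_insert, mem_singleton]
    exact eq_hook_or_of_weight (isWeightedHomogeneous_starPoly G hd) hdt hk hdk

namespace IsUnicyclicWith

variable {c t : ℕ} {φ : Fin c → V}

/-- For `0 < k < t` the hook has no part exceeding `t`; for `k = t` it is the sole contribution to a
vanishing coefficient of `rankPoly`. -/
theorem coeff_componentPoly_eq_zero (h : IsUnicyclicWith G c φ) (hn : Fintype.card V = c + t)
    (ht : t ≠ 0) (hvan : ∀ d, (starPoly G).coeff d ≠ 0 → ∃ k, t ≤ k ∧ d k ≠ 0) {k : ℕ}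
    (hk : k ≤ t) : (componentPoly G).coeff k = 0 := by
  have h3 := h.three_le
  have hr : ∀ j, j ≤ t → (rankPoly G).coeff j = 0 := fun j hj =>
    h.coeff_rankPoly_of_le (by omega)
  rcases Nat.eq_zero_or_pos k with rfl | hk0
  -- The linear coefficient of `rankPoly` is in the vanishing range because `t ≥ 1`.
  · rw [componentPoly_coeff_zero, hr 1 (by omega), hr 0 (by omega), mul_zero, add_zero]
  rcases hk.eq_or_lt with rfl | hkt
  · rw [← coeff_rankPoly_eq_coeff_componentPoly ht (by omega) hvan, hr k le_rfl]
  · rw [← coeff_hook_starPoly G hk0.ne' (by omega)]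
    by_contra hne
    obtain ⟨j, hj, hdj⟩ := hvan _ hne
    simp [show k ≠ j by omega, show (0 : ℕ) ≠ j by omega] at hdj

theorem nonempty_iso_cuttlefish_of_card_eq (h : IsUnicyclicWith G c φ)
    (hn : Fintype.card V = c) : Nonempty (G ≃g cuttlefish c 0) := by
  obtain ⟨m, rfl⟩ : ∃ m, c = m + 3 := ⟨c - 3, by have := h.three_le; omega⟩
  have hb : Function.Bijective φ :=
    (Fintype.bijective_iff_injective_and_card φ).2 ⟨h.injective, by rw [Fintype.card_fin, hn]⟩
  exact h.nonempty_iso_cuttlefish hn (i₀ := 0) (fun i _ => h.degree_eq_two_of_card_eq hn i)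
    fun y hy => absurd (hb.2 y) hy

theorem coeff_componentPoly_succ (h : IsUnicyclicWith G c φ) (hn : Fintype.card V = c + t)
    (ht : t ≠ 0) (hvan : ∀ d, (starPoly G).coeff d ≠ 0 → ∃ k, t ≤ k ∧ d k ≠ 0) :
    (componentPoly G).coeff (t + 1) = (-1) ^ (t + 1) * signedCount G univ ∧
      ∑ S : Finset V with #S = c - 1, signedCount G S = (-1) ^ (t + 1) * signedCount G univ := by
  have h3 := h.three_le
  have h1 := sum_signedCount_of_dvd (G := G) (c := c) (by omega) (by omega)
    (fun S => h.signedCount_eq_zero_of_card_lt)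
  rw [show Fintype.card V - c = t by omega] at h1
  exact h1 (X_pow_dvd_iff.2 fun k hk =>
    h.coeff_componentPoly_eq_zero hn ht hvan (Nat.le_of_lt_succ hk))

theorem nonempty_iso_cuttlefish_of_forall_coeff (h : IsUnicyclicWith G c φ)
    (hn : Fintype.card V = c + t) (ht : t ≠ 0)
    (hvan : ∀ d, (starPoly G).coeff d ≠ 0 → ∃ k, t ≤ k ∧ d k ≠ 0) :
    Nonempty (G ≃g cuttlefish c t) := by
  obtain ⟨m, rfl⟩ : ∃ m, c = m + 3 := ⟨c - 3, by have := h.three_le; omega⟩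
  have h1 := (h.coeff_componentPoly_succ hn ht hvan).2
  obtain ⟨⟨i₀, hi₀⟩, hleaf⟩ := h.degrees_of_abs_sum_signedCount (by
    rw [h1, h.signedCount_univ, abs_mul, abs_mul, abs_pow, abs_pow, abs_neg, abs_one, one_pow,
      one_pow, one_mul, one_mul]
    exact le_abs_self _)
  exact h.nonempty_iso_cuttlefish hn hi₀ hleaf

/-- For `t > 0`, coefficient `t + 1` of `rankPoly`, equal to `(-1)^c`, is the sum of this
coefficient and that of the hook `(t+2, 1^{c-2})`, which is `(-1)^c (c - 1)`. For `t = 0` the two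
partitions coincide and the value is `(-1)^c`. -/
theorem coeff_starPoly_cuttlefishParts_ne_zero (h : IsUnicyclicWith G c φ)
    (hn : Fintype.card V = c + t) (hvan : ∀ d, (starPoly G).coeff d ≠ 0 → ∃ k, t ≤ k ∧ d k ≠ 0) :
    (starPoly G).coeff
      (Finsupp.single t 1 + (Finsupp.single 1 1 + Finsupp.single 0 (c - 3))) ≠ 0 := by
  have h3 := h.three_le
  have hr := h.coeff_rankPoly_succ
  rw [show Fintype.card V - c = t by omega] at hr
  rcases Nat.eq_zero_or_pos t with rfl | ht
  · have h1 := coeff_rankPoly_eq_sum (G := G) (j := 1)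
      {Finsupp.single 1 1 + Finsupp.single 0 (Fintype.card V - 1 - 1)} (by
        simp [Finsupp.weight_single, -Finsupp.single_tsub]) fun d hd hdt => by
          obtain ⟨k, -, hdk⟩ : ∃ k, 0 ≤ k ∧ d k ≠ 0 := hvan d hd
          rw [mem_singleton]
          rcases eq_hook_or_of_weight (t := 0) (isWeightedHomogeneous_starPoly G hd) hdt
            (Nat.zero_le k) hdk with h' | h'
          · exact h'
          · rw [h', add_left_comm, ← Finsupp.single_add]
            congr 2
            omega
    rw [add_left_comm, ← Finsupp.single_add, show 1 + (c - 3) = Fintype.card V - 1 - 1 by omega]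
    rw [zero_add] at hr
    rw [sum_singleton, hr] at h1
    rw [← h1]
    exact pow_ne_zero _ (by norm_num)
  · have h1 := coeff_rankPoly_succ_eq ht.ne' (by omega) hvan
    rw [hr, (h.coeff_componentPoly_succ hn ht.ne' hvan).1, h.signedCount_univ, ← mul_assoc,
      ← pow_add, show Fintype.card V - 3 - t = c - 3 by omega,
      show t + 1 + (Fintype.card V - 1) = c + 2 * t by omega, pow_add, pow_mul, neg_one_sq, one_pow,
      mul_one] at h1
    intro h0
    rw [h0, add_zero] at h1
    have h4 : (1 : ℚ) = c - 1 := mul_left_cancel₀ (pow_ne_zero c (by norm_num : (-1 : ℚ) ≠ 0))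
      ((mul_one _).trans h1)
    have h5 : (3 : ℚ) ≤ c := by exact_mod_cast h3
    linarith

end IsUnicyclicWith

end LeadingTerms

/-! ### Lexicographic order and the leading partition -/

section LeadingPartition
open scoped Classical
open Finset

theorem replicate_sum_le {l : List ℕ} (hl : ∀ x ∈ l, 0 < x) : List.replicate l.sum 1 ≤ l := by
  induction l with
  | nil => exact le_rfl
  | cons x l ih =>
    obtain ⟨y, rfl⟩ : ∃ y, x = y + 1 := ⟨x - 1, by have := hl x List.mem_cons_self; omega⟩
    rw [List.sum_cons, show y + 1 + l.sum = y + l.sum + 1 by ring, List.replicate_succ]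
    rcases Nat.eq_zero_or_pos y with rfl | hy
    · rw [zero_add, zero_add]
      exact List.cons_le_cons _ (ih fun z hz => hl z (List.mem_cons_of_mem _ hz))
    · exact le_of_lt (List.Lex.rel (Nat.lt_add_of_pos_left hy))

/-- A non-increasing list with an entry other than 1 starts with at least 2, and all ones is the
smallest continuation. -/
theorem two_cons_replicate_le {l : List ℕ} (hl : ∀ x ∈ l, 0 < x) (hs : l.Pairwise (· ≥ ·))
    (h1 : ∃ x ∈ l, x ≠ 1) : 2 :: List.replicate (l.sum - 2) 1 ≤ l := by
  rcases l with _ | ⟨x, l⟩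
  · simp at h1
  have hx : 2 ≤ x := by
    by_contra hx
    obtain ⟨y, hy, hy1⟩ := h1
    have h2 := hl y hy
    rcases List.mem_cons.1 hy with rfl | hy
    · omega
    · have := (List.pairwise_cons.1 hs).1 y hy
      omega
  rcases hx.eq_or_lt with rfl | hx
  · rw [List.sum_cons, Nat.add_sub_cancel_left]
    exact List.cons_le_cons _ (replicate_sum_le fun z hz => hl z (List.mem_cons_of_mem _ hz))
  · exact le_of_lt (List.Lex.rel hx)

theorem coe_partitionList {n : ℕ} (lam : n.Partition) :
    ((partitionList lam : List ℕ) : Multiset ℕ) = lam.parts :=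
  Multiset.sort_eq _ _

theorem pairwise_partitionList {n : ℕ} (lam : n.Partition) :
    (partitionList lam).Pairwise (· ≥ ·) :=
  Multiset.pairwise_sort _ _

theorem partitionList_eq {n : ℕ} {lam : n.Partition} {l : List ℕ} (hs : l.Pairwise (· ≥ ·))
    (hl : (l : Multiset ℕ) = lam.parts) : partitionList lam = l :=
  List.Perm.eq_of_pairwise (fun _ _ _ _ h h' => le_antisymm h' h) (pairwise_partitionList lam) hs
    (Multiset.coe_eq_coe.1 ((coe_partitionList lam).trans hl.symm))

/-- If `t = 0`, the part `t + 1` is a 1 and moves behind the 2. -/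
theorem partitionList_eq_of_parts_eq {n c t : ℕ} {lam : n.Partition} (hc : 3 ≤ c)
    (h : lam.parts = cuttlefishParts c t) : partitionList lam =
      if t = 0 then 2 :: List.replicate (c - 2) 1 else (t + 1) :: 2 :: List.replicate (c - 3) 1 := by
  split_ifs with ht
  · subst ht
    refine partitionList_eq (List.pairwise_cons.2 ⟨fun x hx => ?_, ?_⟩) ?_
    · rw [List.eq_of_mem_replicate hx]
      decide
    · exact List.pairwise_replicate_of_refl
    · rw [h, cuttlefishParts, ← Multiset.cons_coe, Multiset.cons_swap, Multiset.coe_replicate,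
        zero_add, ← Multiset.replicate_succ, show c - 3 + 1 = c - 2 by omega]
  · refine partitionList_eq (List.pairwise_cons.2 ⟨fun x hx => ?_,
      List.pairwise_cons.2 ⟨fun x hx => ?_, ?_⟩⟩) ?_
    · rcases List.mem_cons.1 hx with rfl | hx
      · change 2 ≤ t + 1
        omega
      · rw [List.eq_of_mem_replicate hx]
        change 1 ≤ t + 1
        omega
    · rw [List.eq_of_mem_replicate hx]
      decide
    · exact List.pairwise_replicate_of_refl
    · rw [h]
      rfl

theorem partExp_apply {n : ℕ} (lam : n.Partition) (k : ℕ) :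
    partExp lam k = lam.parts.count (k + 1) := by
  conv_rhs => rw [← map_succ_toMultiset_partExp lam]
  rw [← Finsupp.count_toMultiset]
  exact (Multiset.count_map_eq_count' _ _ Nat.succ_injective k).symm

theorem partExp_of_parts_eq {n x m : ℕ} {lam : n.Partition}
    (h : lam.parts = x ::ₘ Multiset.replicate m 1) :
    partExp lam = Finsupp.single (x - 1) 1 + Finsupp.single 0 m := by
  rw [partExp, h, Multiset.map_cons, Multiset.map_replicate, ← Multiset.singleton_add, map_add,
    Multiset.toFinsupp_singleton, ← Multiset.nsmul_singleton, map_nsmul,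
    Multiset.toFinsupp_singleton, Finsupp.smul_single, smul_eq_mul, mul_one]
  rfl

theorem exists_partition_parts_eq_cuttlefishParts {n c t : ℕ} (hc : 3 ≤ c) (hn : n = c + t) :
    ∃ lam : n.Partition, lam.parts = cuttlefishParts c t ∧
      partExp lam = Finsupp.single t 1 + (Finsupp.single 1 1 + Finsupp.single 0 (c - 3)) := by
  obtain ⟨lam, hlam⟩ := exists_partExp_eq (n := n)
    (Finsupp.single t 1 + (Finsupp.single 1 1 + Finsupp.single 0 (c - 3))) (by
      simp only [map_add, Finsupp.weight_single, smul_eq_mul]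
      omega)
  refine ⟨lam, ?_, hlam⟩
  rw [← map_succ_toMultiset_partExp, hlam]
  simp [Finsupp.toMultiset_single, Multiset.nsmul_singleton, cuttlefishParts, -Finsupp.single_tsub,
    Multiset.cons_swap 2]

variable {V : Type*} [Fintype V] {G : SimpleGraph V}

theorem starPoly_eq_iff {W : Type*} [Fintype W] {G' : SimpleGraph W} :
    starPoly G = starPoly G' ↔ chromaticSymmetricFunction G = chromaticSymmetricFunction G' := by
  rw [← starSeriesHom_starPoly, ← starSeriesHom_starPoly, starSeriesHom_injective.eq_iff]

theorem existsUnique_isStarExpansion (G : SimpleGraph V) : ∃! a, IsStarExpansion G a :=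
  ⟨fun lam => (starPoly G).coeff (partExp lam), isStarExpansion_iff.2 fun _ => rfl,
    fun _ ha => funext (isStarExpansion_iff.1 ha)⟩

/-- A partition with all parts at most `t` would be lexicographically smaller than one starting with
`t + 1`. -/
theorem exists_mem_ge_of_isLeadingPartition {c t : ℕ} (hc : 3 ≤ c) (ht : t ≠ 0)
    {lam : (Fintype.card V).Partition} (hlam : IsLeadingPartition G lam)
    (hparts : lam.parts = cuttlefishParts c t) {d : ℕ →₀ ℕ} (hd : (starPoly G).coeff d ≠ 0) :
    ∃ k, t ≤ k ∧ d k ≠ 0 := by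
  by_contra! hcon
  obtain ⟨a, ha, -, hmin⟩ := hlam
  obtain ⟨mu, rfl⟩ := exists_partExp_eq d (isWeightedHomogeneous_starPoly G hd)
  have hle := hmin mu (by rwa [isStarExpansion_iff.1 ha])
  rw [partitionList_eq_of_parts_eq hc hparts, if_neg ht] at hle
  rcases hmu : partitionList mu with _ | ⟨x, l⟩
  · rw [hmu] at hle
    exact absurd List.Lex.nil hle.not_gt
  · have hx : x ∈ mu.parts := by
      rw [← coe_partitionList, hmu, Multiset.mem_coe]
      exact List.mem_cons_self
    have hx0 := mu.parts_pos hx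
    have hxt : x < t + 1 := by
      by_contra hxt
      have := hcon (x - 1) (by omega)
      rw [partExp_apply, Nat.sub_add_cancel hx0, Multiset.count_eq_zero] at this
      exact this hx
    rw [hmu] at hle
    exact absurd (List.Lex.rel hxt) hle.not_gt

namespace IsUnicyclicWith

variable {c t : ℕ} {φ : Fin c → V}

theorem coeff_starPoly_single_zero (h : IsUnicyclicWith G c φ) :
    (starPoly G).coeff (Finsupp.single 0 (Fintype.card V)) = 0 := by
  rw [← h.coeff_rankPoly_of_le (Nat.zero_le _),
    coeff_rankPoly_eq_sum {Finsupp.single 0 (Fintype.card V)} (by simp [Finsupp.weight_single]),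
    sum_singleton]
  intro d hd hd0
  have h1 := isWeightedHomogeneous_starPoly G hd
  rw [eq_single_zero_of_weight_eq_zero hd0, Finsupp.weight_single, zero_add, smul_eq_mul,
    mul_one] at h1
  rw [mem_singleton, ← h1]
  exact eq_single_zero_of_weight_eq_zero hd0

theorem coeff_starPoly_hook_eq_zero (h : IsUnicyclicWith G c φ) (hn : Fintype.card V = c + t)
    (hvan : ∀ d, (starPoly G).coeff d ≠ 0 → ∃ k, t ≤ k ∧ d k ≠ 0) :
    (starPoly G).coeff (Finsupp.single t 1 + Finsupp.single 0 (c - 1)) = 0 := by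
  have h3 := h.three_le
  rcases Nat.eq_zero_or_pos t with rfl | ht
  -- For `t = 0` the hook degenerates to `1^n`.
  · rw [← Finsupp.single_add, show 1 + (c - 1) = Fintype.card V by omega]
    exact h.coeff_starPoly_single_zero
  · rw [show c - 1 = Fintype.card V - 1 - t by omega,
      coeff_hook_starPoly G ht.ne' (by omega)]
    exact h.coeff_componentPoly_eq_zero hn ht.ne' hvan le_rfl

/-- Partitions in the support start with at least `t + 1`. Once `(t+1, 1^{c-1})` is excluded, `(t+1,
2, 1^{c-3})` is the smallest candidate. -/
theorem exists_isLeadingPartition (h : IsUnicyclicWith G c φ) (hn : Fintype.card V = c + t)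
    (hvan : ∀ d, (starPoly G).coeff d ≠ 0 → ∃ k, t ≤ k ∧ d k ≠ 0) :
    ∃ lam, IsLeadingPartition G lam ∧ lam.parts = cuttlefishParts c t := by
  have h3 := h.three_le
  obtain ⟨lam, hparts, hexp⟩ := exists_partition_parts_eq_cuttlefishParts h3 hn
  refine ⟨lam, ⟨fun mu => (starPoly G).coeff (partExp mu), isStarExpansion_iff.2 fun _ => rfl,
    ?_, fun mu hmu => ?_⟩, hparts⟩
  · dsimp only
    rw [hexp]
    exact h.coeff_starPoly_cuttlefishParts_ne_zero hn hvan
  dsimp only at hmu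
  have hcoe := coe_partitionList mu
  have hsort := pairwise_partitionList mu
  have hpos : ∀ x ∈ partitionList mu, 0 < x := fun x hx =>
    mu.parts_pos (by rwa [← hcoe, Multiset.mem_coe])
  have hsum : (partitionList mu).sum = c + t := by
    rw [← Multiset.sum_coe, hcoe, mu.parts_sum, hn]
  obtain ⟨k, hk, hmuk⟩ := hvan _ hmu
  have hk' : k + 1 ∈ partitionList mu := by
    rw [partExp_apply, Multiset.count_ne_zero, ← hcoe, Multiset.mem_coe] at hmuk
    exact hmuk
  rw [partitionList_eq_of_parts_eq h3 hparts]
  rcases hl : partitionList mu with _ | ⟨x, l⟩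
  · rw [hl] at hk'
    exact absurd hk' List.not_mem_nil
  rw [hl] at hsort hpos hsum hk' hcoe
  have hx : t + 1 ≤ x := by
    rcases List.mem_cons.1 hk' with hk' | hk'
    · omega
    · have : k + 1 ≤ x := (List.pairwise_cons.1 hsort).1 _ hk'
      omega
  have hne : ¬ (x = t + 1 ∧ ∀ y ∈ l, y = 1) := by
    rintro ⟨rfl, hl1⟩
    obtain ⟨m, rfl⟩ : ∃ m, l = List.replicate m 1 := ⟨_, List.eq_replicate_of_mem hl1⟩
    have h4 := partExp_of_parts_eq (lam := mu) (x := t + 1) (m := m) hcoe.symm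
    rw [List.sum_cons, List.sum_replicate, smul_eq_mul, mul_one] at hsum
    rw [h4, Nat.add_sub_cancel, show m = c - 1 by omega] at hmu
    exact hmu (h.coeff_starPoly_hook_eq_zero hn hvan)
  split_ifs with ht
  · subst ht
    have h5 := two_cons_replicate_le hpos hsort (by
      by_contra! hcon
      exact hne ⟨hcon x List.mem_cons_self, fun y hy => hcon y (List.mem_cons_of_mem _ hy)⟩)
    rwa [hsum] at h5
  · rcases hx.eq_or_lt with rfl | hx
    · refine List.cons_le_cons _ ?_
      have h5 := two_cons_replicate_le (fun y hy => hpos y (List.mem_cons_of_mem _ hy))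
        (List.pairwise_cons.1 hsort).2 (by
          by_contra! hcon
          exact hne ⟨rfl, hcon⟩)
      rw [List.sum_cons] at hsum
      rwa [show l.sum - 2 = c - 3 by omega] at h5
    · exact le_of_lt (List.Lex.rel hx)

theorem coeff_starPoly_single (h : IsUnicyclicWith G c φ) :
    (starPoly G).coeff (Finsupp.single (Fintype.card V - 1) 1) = (c : ℚ) - 1 := by
  have h3 := h.three_le
  have h4 := h.le_card
  have h1 := coeff_hook_starPoly G (k := Fintype.card V - 1) (by omega) (by omega)
  rwa [Nat.sub_self, Finsupp.single_zero, add_zero, h.coeff_componentPoly_card_sub_one] at h1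

theorem exists_mem_ge_of_eq_cuttlefish (hc : 3 ≤ c)
    (hX : chromaticSymmetricFunction G = chromaticSymmetricFunction (cuttlefish c t))
    {d : ℕ →₀ ℕ} (hd : (starPoly G).coeff d ≠ 0) : ∃ k, t ≤ k ∧ d k ≠ 0 := by
  obtain ⟨m, rfl⟩ : ∃ m, c = m + 3 := ⟨c - 3, by omega⟩
  rw [starPoly_eq_iff.2 hX] at hd
  obtain ⟨k, hk, hdk⟩ := exists_mem_ge_of_coeff_starPoly_ne_zero (isPendantSet_cuttlefish m t) hd
  refine ⟨k, le_trans (le_of_eq ?_) hk, hdk⟩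
  rw [card_image_of_injective _ Sum.inr_injective, card_univ, Fintype.card_fin]

/-- Equality of the functions recovers both parameters: the number of vertices is the degree, and
the cycle length is `c_(n) + 1`. -/
theorem nonempty_iso_cuttlefish_of_eq {k : ℕ} {φ : Fin k → V} (h : IsUnicyclicWith G k φ)
    (hc : 3 ≤ c)
    (hX : chromaticSymmetricFunction G = chromaticSymmetricFunction (cuttlefish c t)) :
    Nonempty (G ≃g cuttlefish c t) := by
  have hvan := fun d => exists_mem_ge_of_eq_cuttlefish (d := d) hc hX
  obtain ⟨m, rfl⟩ : ∃ m, c = m + 3 := ⟨c - 3, by omega⟩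
  have hs := starPoly_eq_iff.2 hX
  have h2 := isUnicyclicWith_cuttlefish m t
  have hcoeff := h.coeff_starPoly_single
  have hk : (3 : ℚ) ≤ k := by exact_mod_cast h.three_le
  -- The degree is determined only for a nonzero polynomial; here `c_(n) = k - 1 > 0`.
  have hne : starPoly G ≠ 0 := by
    intro h0
    rw [h0, MvPolynomial.coeff_zero] at hcoeff
    linarith
  have hw := isWeightedHomogeneous_starPoly (cuttlefish (m + 3) t)
  rw [← hs] at hw
  have hn := (isWeightedHomogeneous_starPoly G).inj_right hne hw
  have hcoeff' := h2.coeff_starPoly_single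
  rw [← hs, ← hn, hcoeff, sub_left_inj, Nat.cast_inj] at hcoeff'
  subst hcoeff'
  rw [Fintype.card_sum, Fintype.card_fin, Fintype.card_fin] at hn
  rcases Nat.eq_zero_or_pos t with rfl | ht
  · exact h.nonempty_iso_cuttlefish_of_card_eq hn
  · exact h.nonempty_iso_cuttlefish_of_forall_coeff hn ht.ne' hvan

end IsUnicyclicWith

end LeadingPartition

theorem mainTheorem5 {V : Type*} [Fintype V] (G : SimpleGraph V) (hG : IsConnectedUnicyclic G) :
    -- the star-expansion of `X_G` exists and is unique
    (∃! a, IsStarExpansion G a) ∧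
    -- the order of the cycle is read off from the coefficient `c_(n)`
    (∀ a k, IsStarExpansion G a → HasCycleOfOrder G k →
      a (Nat.Partition.indiscrete (Fintype.card V)) = (k : ℚ) - 1) ∧
    ∀ c t : ℕ, 3 ≤ c →
      -- cuttlefish are distinguished among all connected unicyclic graphs
      (chromaticSymmetricFunction G = chromaticSymmetricFunction (cuttlefish c t) ↔
        Nonempty (G ≃g cuttlefish c t)) ∧
      -- among those with a `c`-cycle and `c + t` vertices, the leading partition
      -- `(t + 1, 2, 1^{c-3})` is attained by the cuttlefish and by no other graph
      (HasCycleOfOrder G c → Fintype.card V = c + t →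
        ((∃ lam, IsLeadingPartition G lam ∧ lam.parts = cuttlefishParts c t) ↔
          Nonempty (G ≃g cuttlefish c t))) := by
  have hindiscrete : partExp (Nat.Partition.indiscrete (Fintype.card V)) =
      Finsupp.single (Fintype.card V - 1) 1 := by
    have := hG.1.nonempty
    rw [partExp_of_parts_eq (x := Fintype.card V) (m := 0)
      (Nat.Partition.indiscrete_parts Fintype.card_ne_zero), Finsupp.single_zero, add_zero]
  refine ⟨existsUnique_isStarExpansion G, fun a k ha hk => ?_, fun c t hc => ⟨⟨fun hX => ?_, ?_⟩,
    fun hcyc hn => ⟨?_, ?_⟩⟩⟩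
  · obtain ⟨φ, h⟩ := exists_isUnicyclicWith hG hk
    rw [isStarExpansion_iff.1 ha, hindiscrete, h.coeff_starPoly_single]
  · obtain ⟨H, k, hH⟩ := hG.2.exists
    obtain ⟨φ, h⟩ := exists_isUnicyclicWith hG ⟨H, hH⟩
    exact h.nonempty_iso_cuttlefish_of_eq hc hX
  · rintro ⟨e⟩
    exact chromaticSymmetricFunction_congr e
  · rintro ⟨lam, hlam, hparts⟩
    obtain ⟨φ, h⟩ := exists_isUnicyclicWith hG hcyc
    rcases Nat.eq_zero_or_pos t with rfl | ht
    -- For `t = 0` the vertex count suffices and the leading partition carries no information.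
    · exact h.nonempty_iso_cuttlefish_of_card_eq hn
    · exact h.nonempty_iso_cuttlefish_of_forall_coeff hn ht.ne' fun d hd =>
        exists_mem_ge_of_isLeadingPartition hc ht.ne' hlam hparts hd
  · rintro ⟨e⟩
    obtain ⟨φ, h⟩ := exists_isUnicyclicWith hG hcyc
    exact h.exists_isLeadingPartition hn fun d hd =>
      IsUnicyclicWith.exists_mem_ge_of_eq_cuttlefish hc (chromaticSymmetricFunction_congr e) hd
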